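/- For integers $n,a$ let $\begin{bmatrix} n\\ a\end{bmatrix}=\frac{(q;q)_n}{(q;q)_a(q;q)_{n-a}}$ if $0\le a\le n$ and $0$ otherwise, where $(q;q)_n=\prod_{j=1}^{n}(1-q^j)$. For integers $L$ and $K\ge 1$ and rational numbers $\alpha,\beta$ let $$G(L;\alpha,\beta,K)=\sum_{j=-\infty}^{\infty}(-1)^j q^{Kj((\alpha+\beta)j+\alpha-\beta)/2}\begin{bmatrix} 2L\\ L-Kj\end{bmatrix},$$ and write $G(L;\alpha,\beta,K)\ge 0$ if this is a polynomial in $q$ with nonnegative coefficients. Let $k$ be a nonnegative integer and let $a,b$ be coprime integers such that $0<b<2^k a$. Then for all integers $L$: 1. $G(L;\,b-\tfrac1a,\;b,\;2^k a)\ge 0$. 2. $G(L;\,2^i(b-\tfrac1a),\;2^i b,\;2^{k+k'}a)\ge 0$ for all integers $k',i$ with $0\le i\le k'$. 3. $G(L;\alpha,\beta,K)\ge 0$ for every integer $m\ge 0$, where $$\alpha=2^{-m}\bigl(b-\tfrac1a+\tfrac{5}{14}(8^m-1)2^k a\bigr),\quad \beta=2^{-m}\bigl(b+\tfrac{5}{14}(8^m-1)2^k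 a\bigr),\quad K=2^{2m+k}a.$$ 4. $G(L;\alpha,\beta,K)\ge 0$ for every integer $m\ge 1$, where $$\alpha=2^{1-m}\bigl(b-\tfrac1a+\tfrac{1}{28}(3\cdot 8^m-10)2^k a\bigr),\quad \beta=2^{1-m}\bigl(b+\tfrac{1}{28}(3\cdot 8^m-10)2^k a\bigr),\quad K=2^{2m+k-1}a.$$ All of these are cases of Bressoud's generalized Borwein conjecture (which asserts $G(L;\alpha,\beta,K)\ge 0$ whenever its hypotheses hold): in each of them $K,\alpha K,\beta K$ are integers, $0\le\alpha\le K$, $0\le\beta\le K$ and $1\le\alpha+\beta\le 2K-1$. -/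

import Mathlib

open Polynomial

namespace BorweinBressoud

/-- The `q`-shifted factorial `(q;q)_n = ∏_{j=1}^n (1 - q^j)`, with `q = X`. -/
noncomputable def qFact (n : ℕ) : ℤ[X] :=
  ∏ j ∈ Finset.range n, (1 - X ^ (j + 1))

/-- The `q`-binomial coefficient with natural entries, as a polynomial in `q = X`, computed by the
`q`-Pascal rule. It is the polynomial `(q;q)_n / ((q;q)_k (q;q)_{n-k})` for `k ≤ n` (see
`gauss_mul_qFact`) and `0` for `k > n` (see `gauss_eq_zero`). -/
noncomputable def gauss : ℕ → ℕ → ℤ[X]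
  | _, 0 => 1
  | 0, _ + 1 => 0
  | n + 1, k + 1 => gauss n k + X ^ (k + 1) * gauss n (k + 1)

theorem gauss_eq_zero : ∀ (n k : ℕ), n < k → gauss n k = 0
  | _, 0, h => absurd h (Nat.not_lt_zero _)
  | 0, _ + 1, _ => by simp [gauss]
  | n + 1, k + 1, h => by
    rw [gauss, gauss_eq_zero n k (by omega), gauss_eq_zero n (k + 1) (by omega)]
    simp

theorem gauss_self : ∀ n : ℕ, gauss n n = 1
  | 0 => by simp [gauss]
  | n + 1 => by rw [gauss, gauss_self n, gauss_eq_zero n (n + 1) (by omega)]; simp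

/-- The defining quotient formula of the `q`-binomial coefficient, with denominators cleared. -/
theorem gauss_mul_qFact : ∀ m k : ℕ,
    gauss (m + k) k * (qFact k * qFact m) = qFact (m + k)
  | m, 0 => by simp [gauss, qFact]
  | 0, k + 1 => by
    rw [Nat.zero_add, gauss_self]; simp [qFact]
  | m + 1, k + 1 => by
    have h1 := gauss_mul_qFact (m + 1) k
    have h2 := gauss_mul_qFact m (k + 1)
    have e : m + (k + 1) = m + 1 + k := by omega
    rw [e] at h2
    have s : ∀ n, qFact (n + 1) = qFact n * (1 - X ^ (n + 1)) := fun n => by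
      simp [qFact, Finset.prod_range_succ]
    have e2 : m + 1 + (k + 1) = (m + 1 + k) + 1 := by omega
    rw [e2, gauss, s (m + 1 + k)]
    have h1' : gauss (m + 1 + k) k * (qFact (k + 1) * qFact (m + 1))
        = qFact (m + 1 + k) * (1 - X ^ (k + 1)) := by
      rw [s k, ← h1]; ring
    have h2' : gauss (m + 1 + k) (k + 1) * (qFact (k + 1) * qFact (m + 1))
        = qFact (m + 1 + k) * (1 - X ^ (m + 1)) := by
      rw [s m, ← h2]; ring
    rw [add_mul, h1', mul_assoc, h2']
    ring

/-- The `q`-binomial coefficient with integer entries: it vanishes unless `a ∈ {0, …, n}`. -/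
noncomputable def qBinom (n a : ℤ) : ℤ[X] :=
  if 0 ≤ a ∧ a ≤ n then gauss n.toNat a.toNat else 0

/-- Finite integer combinations of powers `q^e` with rational exponents `e`. -/
abbrev QExpr : Type := AddMonoidAlgebra ℤ ℚ

/-- The power `q^e`. -/
noncomputable def qPow (e : ℚ) : QExpr := AddMonoidAlgebra.single e 1

/-- A polynomial in `q`, seen as a combination of powers of `q` (substitution `X ↦ q`). -/
noncomputable def ofPoly (P : ℤ[X]) : QExpr := aeval (qPow 1) P

/-- The `j`-th term of `G(N, M; α, β, K; q)`. -/
noncomputable def GTerm (N M : ℤ) (α β : ℚ) (K j : ℤ) : QExpr :=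
  (j.negOnePow : ℤ) •
    (qPow ((K : ℚ) * j * ((α + β) * j + α - β) / 2) * ofPoly (qBinom (M + N) (N - K * j)))

/-- `G(N, M; α, β, K; q) = ∑_{j ∈ ℤ} (-1)^j q^{K j ((α + β) j + α - β) / 2} [M + N, N - K j]_q`;
for `K ≠ 0` only finitely many terms do not vanish (see `finite_support_GTerm`). -/
noncomputable def G₂ (N M : ℤ) (α β : ℚ) (K : ℤ) : QExpr :=
  ∑ᶠ j : ℤ, GTerm N M α β K j

theorem finite_support_GTerm (N M : ℤ) (α β : ℚ) (K : ℤ) (hK : K ≠ 0) :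
    (Function.support (GTerm N M α β K)).Finite := by
  refine (Set.finite_Icc (-(|N| + |M|)) (|N| + |M|)).subset fun j hj => ?_
  have h : 0 ≤ N - K * j ∧ N - K * j ≤ M + N := by
    by_contra h
    exact hj (by rw [GTerm, qBinom, if_neg h, ofPoly, map_zero, mul_zero, smul_zero])
  have h1 : |K * j| ≤ |N| + |M| := by
    rw [abs_le]
    have := neg_abs_le M; have := le_abs_self M; have := neg_abs_le N; have := le_abs_self N
    constructor <;> linarith [abs_nonneg N, abs_nonneg M]
  have h2 : |j| ≤ |K * j| := by
    rw [abs_mul]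
    exact le_mul_of_one_le_left (abs_nonneg j) (Int.one_le_abs hK)
  exact abs_le.mp (h2.trans h1)

/-- `G(L; α, β, K; q) = G(L, L; α, β, K; q)`. -/
noncomputable def G (L : ℤ) (α β : ℚ) (K : ℤ) : QExpr := G₂ L L α β K

/-- `f ≥ 0`: `f` is a polynomial in `q` all of whose coefficients are nonnegative. -/
def IsNonnegPoly (f : QExpr) : Prop :=
  ∃ P : ℤ[X], (∀ n : ℕ, 0 ≤ P.coeff n) ∧ f = ofPoly P

/-- The hypotheses on `K, α, β` in (the case `N = M` of) Bressoud's generalized Borwein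
conjecture. -/
def IsBressoudParam (α β : ℚ) (K : ℤ) : Prop :=
  (∃ m : ℤ, α * K = m) ∧ (∃ m : ℤ, β * K = m) ∧ 0 ≤ α ∧ α ≤ K ∧ 0 ≤ β ∧ β ≤ K ∧
    1 ≤ α + β ∧ α + β ≤ 2 * K - 1

/-- `(α, β, K)` is an instance of Bressoud's generalized Borwein conjecture (case `N = M`) for which
the conjecture is true: the hypotheses hold, and so does `G(L; α, β, K; q) ≥ 0` for all `L`. -/
def BressoudCaseHolds (α β : ℚ) (K : ℤ) : Prop :=
  IsBressoudParam α β K ∧ ∀ L : ℤ, IsNonnegPoly (G L α β K)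

end BorweinBressoud

/-! Call the exponent sequence e and modulus K positive if ∑_j (-1)^j q^(e j) [2L, L - Kj] has
nonnegative coefficients for all L. Every case of the theorem is reached from explicitly summable
alternating sums by operations that visibly preserve nonnegativity.

A polynomial kernel κ with nonnegative coefficients and ∑_r κ(L, r) [2r, r - j]_{q^p} = q^(c j²)
[2L, L - 2j]_q, once j is replaced by Kj and the identity is summed against the alternating weights,
turns positivity for (α, β, K) into positivity for ((pα + cK)/2, (pβ + cK)/2, 2K)
(`IsPositive.transform`, `exists_exponent_transform`). Five kernels occur, with (p, c) = (2,0),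
(2,2), (4,0), (2,1), (1,1). The first three are connection coefficients between [2L, L - s] and
continuous q-Hermite coefficients (`sum_quadratic`, `sum_quadratic_dual`, `sum_quartic`). The fourth
comes from a WZ pair (`sum_selfDualTerm`), the fifth from two applications of q-Vandermonde
(`sum_rogersSzego`).

The starting cases come from the Burge tree. To coprime a, b > 0 belongs an alternating sum of
products of two q-binomials. For a = b = 1 it equals q^(LM) [L+M, L] (`sum_alternating_mul_fBinom`).
The step (a, b) → (a+b, b) is a positive transformation by q-Pfaff–Saalschütz (`sum_burgeProd`), and
(a, b) → (b, a) is a symmetry, so the subtractive Euclidean algorithm reaches every coprime pair. A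
limiting form of the step (`sum_burgeProd_limit`) replaces the product by one q-binomial and yields
(b - 1/a, b, a) for b < a. The kernels (2,0) and (2,2) then double K while keeping b or adding K to
it, which covers b < 2^k a (`isPositive_burgeExp_mul`).

Family 2 iterates (4,0) and then (2,0); families 3 and 4 alternate (2,1) and (1,1).

The q-identities are proved in a field with generic q, where division and negative indices are
harmless, and pulled back to ℤ[X] through its fraction field. -/

namespace BorweinBressoud

set_option linter.unusedSimpArgs false

/-! ### q-factorials with integer index, and connection coefficients from three-term recurrences -/

section Field

variable {K : Type*} [Field K]

/-- `(q;q)_n` in a field. -/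
noncomputable def qPoch (q : K) (n : ℕ) : K := ∏ i ∈ Finset.range n, (1 - q ^ (i + 1))

/-- `1 / (q;q)_n` for integers `n`, which vanishes for `n < 0`. -/
noncomputable def invPoch (q : K) : ℤ → K
  | Int.ofNat n => (qPoch q n)⁻¹
  | Int.negSucc _ => 0

/-- The `q`-binomial coefficient in a field. -/
noncomputable def fBinom (q : K) (n : ℕ) (k : ℤ) : K :=
  qPoch q n * invPoch q k * invPoch q (n - k)

theorem qPoch_zero (q : K) : qPoch q 0 = 1 := by simp [qPoch]

theorem qPoch_succ (q : K) (n : ℕ) : qPoch q (n + 1) = (1 - q ^ (n + 1)) * qPoch q n := by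
  rw [qPoch, Finset.prod_range_succ, mul_comm, qPoch]

theorem qPoch_ne_zero {q : K} (hq : ∀ n : ℕ, q ^ (n + 1) ≠ 1) (n : ℕ) : qPoch q n ≠ 0 :=
  Finset.prod_ne_zero_iff.mpr fun i _ => sub_ne_zero.mpr (hq i).symm

theorem invPoch_natCast (q : K) (n : ℕ) : invPoch q n = (qPoch q n)⁻¹ := rfl

theorem invPoch_zero (q : K) : invPoch q 0 = 1 := by
  have := invPoch_natCast q 0
  simpa [qPoch_zero] using this

theorem invPoch_of_neg (q : K) {n : ℤ} (h : n < 0) : invPoch q n = 0 := by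
  obtain ⟨m, rfl⟩ := Int.eq_negSucc_of_lt_zero h
  rfl

/-- Valid at every integer: at n = 0 the factor 1 - q^0 vanishes together with `invPoch q (-1)`.
This is what lets all later recurrences and telescoping identities hold at the ends of the summation
range without case distinctions. -/
theorem invPoch_pred {q : K} (hq : ∀ n : ℕ, q ^ (n + 1) ≠ 1) {n m : ℤ} (h : m = n - 1) :
    invPoch q m = (1 - q ^ n) * invPoch q n := by
  subst h
  rcases lt_trichotomy n 0 with h | rfl | h
  · rw [invPoch_of_neg q h, invPoch_of_neg q (by omega), mul_zero]
  · rw [invPoch_of_neg q (by omega)]; simp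
  · obtain ⟨k, rfl⟩ : ∃ k : ℕ, n = (k + 1 : ℕ) := ⟨(n - 1).toNat, by omega⟩
    have e : ((k + 1 : ℕ) : ℤ) - 1 = (k : ℕ) := by push_cast; ring
    rw [e, invPoch_natCast, invPoch_natCast, qPoch_succ, zpow_natCast, mul_inv,
      mul_inv_cancel_left₀ (sub_ne_zero.mpr (hq k).symm)]

theorem fBinom_of_neg (q : K) (n : ℕ) {k : ℤ} (h : k < 0) : fBinom q n k = 0 := by
  rw [fBinom, invPoch_of_neg q h, mul_zero, zero_mul]

theorem fBinom_of_lt (q : K) (n : ℕ) {k : ℤ} (h : n < k) : fBinom q n k = 0 := by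
  rw [fBinom, invPoch_of_neg q (n := n - k) (by omega), mul_zero]

theorem aeval_qFact (q : K) (n : ℕ) : aeval q (qFact n) = qPoch q n := by
  simp [qFact, qPoch]

theorem aeval_gauss {q : K} (hq : ∀ n : ℕ, q ^ (n + 1) ≠ 1) (n k : ℕ) :
    aeval q (gauss n k) = fBinom q n k := by
  rcases lt_or_ge n k with h | h
  · rw [gauss_eq_zero n k h, fBinom_of_lt q n (by omega), map_zero]
  · obtain ⟨m, rfl⟩ := Nat.exists_eq_add_of_le' h
    have := congrArg (aeval q) (gauss_mul_qFact m k)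
    simp only [map_mul, aeval_qFact] at this
    have e : ((m + k : ℕ) : ℤ) - k = (m : ℕ) := by push_cast; ring
    rw [fBinom, e, invPoch_natCast, invPoch_natCast, ← this]
    field_simp [qPoch_ne_zero hq k, qPoch_ne_zero hq m]

theorem aeval_qBinom {q : K} (hq : ∀ n : ℕ, q ^ (n + 1) ≠ 1) (n : ℕ) (k : ℤ) :
    aeval q (qBinom n k) = fBinom q n k := by
  unfold qBinom
  split_ifs with h
  · rw [aeval_gauss hq, Int.toNat_natCast, Int.toNat_of_nonneg h.1]
  · rw [map_zero]
    rcases lt_or_ge k 0 with h' | h'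
    · rw [fBinom_of_neg q n h']
    · rw [fBinom_of_lt q n (by omega)]

/-- The two-sided product with `zprod f 0 = 1` and `zprod f (m + 1) = f (m + 1) * zprod f m`. -/
noncomputable def zprod (f : ℤ → K) : ℤ → K
  | Int.ofNat n => ∏ i ∈ Finset.range n, f (i + 1)
  | Int.negSucc n => (∏ i ∈ Finset.range (n + 1), f (-i))⁻¹

theorem zprod_natCast (f : ℤ → K) (n : ℕ) : zprod f n = ∏ i ∈ Finset.range n, f (i + 1) := rfl

theorem zprod_zero (f : ℤ → K) : zprod f 0 = 1 := by
  simpa using zprod_natCast f 0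

theorem zprod_succ {f : ℤ → K} (hf : ∀ m, f m ≠ 0) {m n : ℤ} (h : n = m + 1) :
    zprod f n = f n * zprod f m := by
  subst h
  rcases m with n | n
  · change zprod f ((n + 1 : ℕ) : ℤ) = f ((n : ℤ) + 1) * zprod f (n : ℕ)
    rw [zprod_natCast, zprod_natCast, Finset.prod_range_succ, mul_comm]
  · rcases n with _ | n
    · have : Int.negSucc 0 + 1 = 0 := rfl
      rw [this, zprod_zero]
      simp [zprod, hf]
    · have e : Int.negSucc (n + 1) + 1 = Int.negSucc n := by omega
      have e' : f (Int.negSucc n) = f (-((n + 1 : ℕ) : ℤ)) := rfl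
      rw [e, zprod, zprod, Finset.prod_range_succ _ (n + 1), e', mul_inv, mul_left_comm,
        mul_inv_cancel₀ (hf _), mul_one]

theorem zprod_ne_zero {f : ℤ → K} (hf : ∀ m, f m ≠ 0) : ∀ m, zprod f m ≠ 0
  | Int.ofNat _ => Finset.prod_ne_zero_iff.mpr fun _ _ => hf _
  | Int.negSucc _ => inv_ne_zero (Finset.prod_ne_zero_iff.mpr fun _ _ => hf _)

/-- `[n, (n - s) / 2]` if `n ≡ s (mod 2)`, and `0` otherwise: the coefficients of the continuous
`q`-Hermite polynomials. -/
noncomputable def hermiteCoeff (q : K) (n : ℕ) (s : ℤ) : K :=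
  if (2 : ℤ) ∣ n - s then fBinom q n ((n - s) / 2) else 0

theorem hermiteCoeff_eq (q : K) {n : ℕ} {s k : ℤ} (h : n - s = 2 * k) :
    hermiteCoeff q n s = fBinom q n k := by
  rw [hermiteCoeff, if_pos ⟨k, h⟩, h, Int.mul_ediv_cancel_left k two_ne_zero]

theorem hermiteCoeff_of_not_dvd (q : K) {n : ℕ} {s : ℤ} (h : ¬ (2 : ℤ) ∣ n - s) :
    hermiteCoeff q n s = 0 := if_neg h

theorem hermiteCoeff_zero {q : K} (hq : ∀ n : ℕ, q ^ (n + 1) ≠ 1) (s : ℤ) :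
    hermiteCoeff q 0 (s - 1) + hermiteCoeff q 0 (s + 1) = hermiteCoeff q 1 s := by
  by_cases h : (2 : ℤ) ∣ 1 - s
  · obtain ⟨k, hk⟩ := h
    rw [hermiteCoeff_eq q (n := 0) (s := s - 1) (k := k) (by push_cast; omega),
      hermiteCoeff_eq q (n := 0) (s := s + 1) (k := k - 1) (by push_cast; omega),
      hermiteCoeff_eq q (n := 1) (s := s) (k := k) (by push_cast; omega)]
    simp only [fBinom, qPoch_succ, qPoch_zero]
    rcases lt_trichotomy k 0 with h | rfl | h
    · simp [invPoch_of_neg q h, invPoch_of_neg q (n := k - 1) (by omega)]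
    · have h1 : invPoch q 0 = (1 - q ^ (1 : ℤ)) * invPoch q 1 := invPoch_pred hq rfl
      simp only [zpow_one] at h1
      simp [invPoch_of_neg, invPoch_zero, ← h1]
    · rcases eq_or_ne k 1 with rfl | h'
      · have h1 : invPoch q 0 = (1 - q ^ (1 : ℤ)) * invPoch q 1 := invPoch_pred hq rfl
        simp only [zpow_one] at h1
        simp [invPoch_of_neg, invPoch_zero, ← h1]
      · simp [invPoch_of_neg q (n := -k) (by omega), invPoch_of_neg q (n := 1 - k) (by omega)]
  · rw [hermiteCoeff_of_not_dvd q (n := 0) (by push_cast; omega),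
      hermiteCoeff_of_not_dvd q (n := 0) (by push_cast; omega),
      hermiteCoeff_of_not_dvd q (n := 1) (by push_cast; omega), add_zero]

/-- If H_n(z) is the Laurent polynomial with coefficients `hermiteCoeff q n s` at z^s, this is the
recurrence (z + 1/z) H_n = H_{n+1} + (1 - q^n) H_{n-1} of the continuous q-Hermite polynomials. -/
theorem hermiteCoeff_succ {q : K} (hq : ∀ n : ℕ, q ^ (n + 1) ≠ 1) (hq0 : q ≠ 0) (n : ℕ) (s : ℤ) :
    hermiteCoeff q (n + 1) (s - 1) + hermiteCoeff q (n + 1) (s + 1) =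
      hermiteCoeff q (n + 2) s + (1 - q ^ (n + 1)) * hermiteCoeff q n s := by
  by_cases h : (2 : ℤ) ∣ n - s
  · obtain ⟨k, hk⟩ := h
    rw [hermiteCoeff_eq q (n := n + 1) (s := s - 1) (k := k + 1) (by push_cast; omega),
      hermiteCoeff_eq q (n := n + 1) (s := s + 1) (k := k) (by push_cast; omega),
      hermiteCoeff_eq q (n := n + 2) (s := s) (k := k + 1) (by push_cast; omega),
      hermiteCoeff_eq q (n := n) (s := s) (k := k) hk]
    simp only [fBinom, qPoch_succ]
    push_cast
    rw [invPoch_pred hq (m := k) (n := k + 1) (by ring),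
      invPoch_pred hq (m := n + 1 - (k + 1)) (n := n + 1 - k) (by ring),
      invPoch_pred hq (m := n - k) (n := n + 1 - k) (by ring),
      show (n : ℤ) + 2 - (k + 1) = n + 1 - k by ring]
    simp only [zpow_add₀ hq0, zpow_sub₀ hq0, zpow_natCast, zpow_one, pow_succ]
    field_simp
    ring
  · rw [hermiteCoeff_of_not_dvd q (n := n + 1) (by push_cast; omega),
      hermiteCoeff_of_not_dvd q (n := n + 1) (by push_cast; omega),
      hermiteCoeff_of_not_dvd q (n := n + 2) (by push_cast; omega),
      hermiteCoeff_of_not_dvd q h]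
    ring

/-- Connection coefficients with respect to a family satisfying a three-term recurrence. -/
theorem sum_mul_eq_of_recurrence (h : ℕ → ℤ → K) (lam : ℕ → K)
    (h0 : ∀ s, h 0 (s - 1) + h 0 (s + 1) = h 1 s)
    (hs : ∀ n s, h (n + 1) (s - 1) + h (n + 1) (s + 1) = h (n + 2) s + lam (n + 1) * h n s)
    (R : ℕ → ℤ → K) (x y z : ℕ → K) (hR0 : ∀ s, R 0 s = h 0 s)
    (hR1 : ∀ s, R 1 s = x 0 * (R 0 (s - 1) + R 0 (s + 1)) + y 0 * R 0 s)
    (hR : ∀ L s, R (L + 2) s = x (L + 1) * (R (L + 1) (s - 1) + R (L + 1) (s + 1)) +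
      y (L + 1) * R (L + 1) s + z (L + 1) * R L s)
    (C : ℕ → ℤ → K) (hneg : ∀ L n, n < 0 → C L n = 0) (hlt : ∀ L : ℕ, ∀ n : ℤ, L < n → C L n = 0)
    (hC0 : C 0 0 = 1)
    (hC1 : ∀ n : ℕ, C 1 n = x 0 * (C 0 (n - 1) + lam (n + 1) * C 0 (n + 1)) + y 0 * C 0 n)
    (hC : ∀ L n : ℕ, C (L + 2) n = x (L + 1) * (C (L + 1) (n - 1) + lam (n + 1) * C (L + 1) (n + 1))
      + y (L + 1) * C (L + 1) n + z (L + 1) * C L n) (L : ℕ) :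
    ∀ N : ℕ, L < N → ∀ s, ∑ n ∈ Finset.range N, C L n * h n s = R L s := by
  -- Summation by parts: multiplication by z + 1/z is moved from the family h to the coefficients C.
  -- It raises the index n by at most one, hence `N + 1` on the right.
  have key : ∀ L N : ℕ, L < N → ∀ s, ∑ n ∈ Finset.range N, C L n * (h n (s - 1) + h n (s + 1)) =
      ∑ n ∈ Finset.range (N + 1), (C L (n - 1) + lam (n + 1) * C L (n + 1)) * h n s := by
    intro L N hN s
    obtain ⟨N, rfl⟩ := Nat.exists_eq_add_of_lt (Nat.zero_lt_of_lt hN)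
    simp only [zero_add]
    rw [Finset.sum_range_succ', Nat.cast_zero, h0]
    simp only [hs, mul_add, add_mul, Finset.sum_add_distrib]
    rw [Finset.sum_range_succ' (fun n : ℕ => C L ((n : ℤ) - 1) * h n s),
      Finset.sum_range_succ' (fun n : ℕ => C L (((n + 1 : ℕ) : ℤ) - 1) * h (n + 1) s),
      Finset.sum_range_succ (fun n : ℕ => lam (n + 1) * C L ((n : ℤ) + 1) * h n s),
      Finset.sum_range_succ (fun n : ℕ => lam (n + 1) * C L ((n : ℤ) + 1) * h n s)]
    rw [hlt L ((N : ℤ) + 1) (by omega), hlt L (((N + 1 : ℕ) : ℤ) + 1) (by omega),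
      hneg L (((0 : ℕ) : ℤ) - 1) (by omega)]
    have e1 : ∀ n : ℕ, C L (((n + 1 + 1 : ℕ) : ℤ) - 1) = C L ((n + 1 : ℕ) : ℤ) := fun n => by
      congr 1; push_cast; ring
    have e2 : C L (((0 + 1 : ℕ) : ℤ) - 1) = C L 0 := by congr 1
    have e3 : ∀ n : ℕ, lam (n + 1) * C L ((n : ℤ) + 1) * h n s =
      C L ((n + 1 : ℕ) : ℤ) * (lam (n + 1) * h n s) := fun n => by push_cast; ring
    simp only [e1, e2, e3]
    ring
  induction L using Nat.strong_induction_on with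
  | _ L ih =>
    intro N hN s
    rcases L with _ | _ | L
    · obtain ⟨N, rfl⟩ := Nat.exists_eq_add_of_lt hN
      rw [Finset.sum_range_succ', Finset.sum_eq_zero fun n _ => by
        rw [hlt 0 ((n + 1 : ℕ) : ℤ) (by omega), zero_mul]]
      simp [hC0, hR0]
    · obtain ⟨N, rfl⟩ : ∃ M, N = M + 1 := ⟨N - 1, by omega⟩
      have i1 := ih 0 (by omega)
      rw [hR1, ← i1 N (by omega) (s - 1), ← i1 N (by omega) (s + 1), ← Finset.sum_add_distrib]
      simp only [← mul_add]
      rw [key 0 N (by omega), ← i1 (N + 1) (by omega) s, Finset.mul_sum, Finset.mul_sum,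
        ← Finset.sum_add_distrib]
      refine Finset.sum_congr rfl fun n _ => ?_
      rw [zero_add, hC1]; ring
    · obtain ⟨N, rfl⟩ : ∃ M, N = M + 1 := ⟨N - 1, by omega⟩
      have i1 := ih (L + 1) (by omega)
      rw [hR, ← i1 N (by omega) (s - 1), ← i1 N (by omega) (s + 1), ← Finset.sum_add_distrib]
      simp only [← mul_add]
      rw [key (L + 1) N (by omega), ← i1 (N + 1) (by omega) s,
        ← ih L (by omega) (N + 1) (by omega) s, Finset.mul_sum, Finset.mul_sum, Finset.mul_sum,
        ← Finset.sum_add_distrib, ← Finset.sum_add_distrib]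
      refine Finset.sum_congr rfl fun n _ => ?_
      rw [hC]; ring

end Field

/-! ### Expansions of [2L, L - s] in q-Hermite coefficients -/

section Recurrence

variable {K : Type*} [Field K]

/-- `q` is neither zero nor a root of unity, and the characteristic is not two. -/
structure IsGeneric (q : K) : Prop where
  ne_zero : q ≠ 0
  zpow_ne_one : ∀ n : ℤ, n ≠ 0 → q ^ n ≠ 1
  two_ne_zero : (2 : K) ≠ 0

namespace IsGeneric

variable {q : K} (hq : IsGeneric q)
include hq

theorem pow_succ_ne_one (n : ℕ) : q ^ (n + 1) ≠ 1 := by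
  have := hq.zpow_ne_one ((n + 1 : ℕ) : ℤ) (by omega)
  rwa [zpow_natCast] at this

theorem one_add_zpow_ne_zero (m : ℤ) : 1 + q ^ m ≠ 0 := by
  intro h
  have h1 : q ^ m = -1 := by linear_combination h
  rcases eq_or_ne m 0 with rfl | hm
  · exact hq.two_ne_zero (by rw [← h, zpow_zero]; norm_num)
  · refine hq.zpow_ne_one (m * 2) (by omega) ?_
    rw [zpow_mul, h1]; norm_num

theorem pow {p : ℕ} (hp : p ≠ 0) : IsGeneric (q ^ p) where
  ne_zero := pow_ne_zero _ hq.ne_zero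
  zpow_ne_one n hn := by
    rw [← zpow_natCast, ← zpow_mul]
    exact hq.zpow_ne_one _ (mul_ne_zero (by exact_mod_cast hp) hn)
  two_ne_zero := hq.two_ne_zero

end IsGeneric

variable {q : K}

theorem fBinom_two_mul (q : K) (L : ℕ) (s : ℤ) :
    fBinom q (2 * L) (L - s) = qPoch q (2 * L) * invPoch q (L - s) * invPoch q (L + s) := by
  rw [fBinom]; congr 2; push_cast; ring

/-- The last term is (1 - q^(2L)) (1 - q^(2L-1)) [2L-2, L-1-s], written with `invPoch` so that it
makes sense, and vanishes, at L = 0. -/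
theorem fBinom_two_mul_succ (hq : IsGeneric q) (L : ℕ) (s : ℤ) :
    fBinom q (2 * (L + 1)) ((L + 1 : ℕ) - s) =
      fBinom q (2 * L) (L - (s - 1)) + fBinom q (2 * L) (L - (s + 1)) +
      (q ^ (2 * L + 1) + q ^ (2 * L)) * fBinom q (2 * L) (L - s) -
      qPoch q (2 * L) * invPoch q (L - 1 - s) * invPoch q (L - 1 + s) := by
  simp only [fBinom_two_mul]
  have h0 := hq.ne_zero
  have h := hq.pow_succ_ne_one
  rw [show 2 * (L + 1) = 2 * L + 1 + 1 by ring, qPoch_succ, qPoch_succ,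
    invPoch_pred h (m := L - 1 - s) (n := L - s) (by ring),
    invPoch_pred h (m := L - 1 + s) (n := L + s) (by ring),
    show (L : ℤ) - (s - 1) = (L + 1 : ℕ) - s by push_cast; ring,
    show (L : ℤ) + (s + 1) = (L + 1 : ℕ) + s by push_cast; ring,
    invPoch_pred h (m := L + (s - 1)) (n := L + s) (by ring),
    invPoch_pred h (m := L - (s + 1)) (n := L - s) (by ring),
    invPoch_pred h (m := L - s) (n := (L + 1 : ℕ) - s) (by push_cast; ring),
    invPoch_pred h (m := L + s) (n := (L + 1 : ℕ) + s) (by push_cast; ring)]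
  push_cast
  simp only [zpow_add₀ h0, zpow_sub₀ h0, zpow_natCast, zpow_one, pow_succ, pow_mul']
  field_simp
  ring

theorem qPoch_mul_invPoch_pred_eq (q : K) (L : ℕ) (s : ℤ) :
    qPoch q (2 * (L + 1)) * invPoch q ((L + 1 : ℕ) - 1 - s) * invPoch q ((L + 1 : ℕ) - 1 + s) =
      (1 - q ^ (2 * L + 2)) * (1 - q ^ (2 * L + 1)) * fBinom q (2 * L) (L - s) := by
  rw [fBinom_two_mul, show 2 * (L + 1) = 2 * L + 1 + 1 by ring, qPoch_succ, qPoch_succ,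
    show ((L + 1 : ℕ) : ℤ) - 1 = L by push_cast; ring]
  ring

theorem invPoch_mul_invPoch_of_neg (q : K) {m n : ℤ} (h : m + n < 0) :
    invPoch q m * invPoch q n = 0 := by
  rcases lt_or_ge m 0 with h' | h'
  · rw [invPoch_of_neg q h', zero_mul]
  · rw [invPoch_of_neg q (n := n) (by omega), mul_zero]

theorem fBinom_zero_eq_hermiteCoeff (q Q : K) (s : ℤ) :
    fBinom q (2 * 0) ((0 : ℕ) - s) = hermiteCoeff Q 0 s := by
  rcases eq_or_ne s 0 with rfl | hs
  · rw [hermiteCoeff_eq Q (k := 0) (by simp)]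
    simp [fBinom, qPoch_zero, invPoch_zero]
  · have : fBinom q (2 * 0) ((0 : ℕ) - s) = 0 := by
      rcases lt_or_gt_of_ne hs with h | h
      · exact fBinom_of_lt _ _ (by push_cast; omega)
      · exact fBinom_of_neg _ _ (by push_cast; omega)
    rw [this]
    by_cases h : (2 : ℤ) ∣ ((0 : ℕ) : ℤ) - s
    · obtain ⟨k, hk⟩ := h
      rw [hermiteCoeff_eq Q hk]
      rcases lt_or_ge k 0 with h' | h'
      · rw [fBinom_of_neg _ _ h']
      · rw [fBinom_of_lt _ _ (by push_cast at hk ⊢; omega)]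
    · rw [hermiteCoeff_of_not_dvd Q h]

/-- If coefficients `C L n` satisfy the recurrence dual to that of `[2L, L - s]`, then they connect
the latter with the `Q`-Hermite coefficients. -/
theorem sum_mul_hermiteCoeff_eq_fBinom (hq : IsGeneric q) {Q : K} (hQ : IsGeneric Q)
    (C D : ℕ → ℤ → K) (hneg : ∀ L n, n < 0 → C L n = 0) (hlt : ∀ L : ℕ, ∀ n : ℤ, L < n → C L n = 0)
    (hC0 : C 0 0 = 1)
    (hC : ∀ L n : ℕ, C (L + 1) n = C L (n - 1) + (1 - Q ^ (n + 1)) * C L (n + 1)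
      + (q ^ (2 * L + 1) + q ^ (2 * L)) * C L n - D L n)
    (hD0 : ∀ n : ℕ, D 0 n = 0)
    (hD : ∀ L n : ℕ, D (L + 1) n = (1 - q ^ (2 * L + 2)) * (1 - q ^ (2 * L + 1)) * C L n)
    {L N : ℕ} (hN : L < N) (s : ℤ) :
    ∑ n ∈ Finset.range N, C L n * hermiteCoeff Q n s = fBinom q (2 * L) (L - s) := by
  -- The last coefficient sequence enters only at indices L + 1, so the truncated subtraction in its
  -- exponent 2 * L - 1 is harmless.
  refine sum_mul_eq_of_recurrence (hermiteCoeff Q) (fun n => 1 - Q ^ n)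
    (hermiteCoeff_zero hQ.pow_succ_ne_one)
    (hermiteCoeff_succ hQ.pow_succ_ne_one hQ.ne_zero) (fun L s => fBinom q (2 * L) (L - s))
    (fun _ => 1) (fun L => q ^ (2 * L + 1) + q ^ (2 * L))
    (fun L => -((1 - q ^ (2 * L)) * (1 - q ^ (2 * L - 1)))) (fun s => fBinom_zero_eq_hermiteCoeff q Q s)
    (fun s => ?_) (fun L s => ?_) C hneg hlt hC0 (fun n => ?_) (fun L n => ?_) L N hN s
  · have := fBinom_two_mul_succ hq 0 s
    rw [mul_assoc, invPoch_mul_invPoch_of_neg q (m := (0 : ℕ) - 1 - s) (by push_cast; omega)] at this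
    rw [this]; ring
  · have := fBinom_two_mul_succ hq (L + 1) s
    rw [qPoch_mul_invPoch_pred_eq] at this
    rw [this, show 2 * (L + 1) - 1 = 2 * L + 1 by omega]; ring
  · rw [hC, hD0]; ring
  · rw [hC, hD, show 2 * (L + 1) - 1 = 2 * L + 1 by omega]; ring

/-- `(-q;q)_m`, extended to integers `m`. -/
noncomputable def negPoch (q : K) : ℤ → K := zprod fun m => 1 + q ^ m

theorem negPoch_succ (hq : IsGeneric q) {m n : ℤ} (h : n = m + 1) :
    negPoch q n = (1 + q ^ n) * negPoch q m := zprod_succ hq.one_add_zpow_ne_zero h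

theorem negPoch_ne_zero (hq : IsGeneric q) (n : ℤ) : negPoch q n ≠ 0 :=
  zprod_ne_zero hq.one_add_zpow_ne_zero n

/-- `q ^ (m (m - 1) / 2)` for integers `m`. -/
noncomputable def triPow (q : K) : ℤ → K := zprod fun m => q ^ (m - 1)

theorem triPow_succ (hq : IsGeneric q) {m n : ℤ} (h : n = m + 1) :
    triPow q n = q ^ m * triPow q m := by
  have := zprod_succ (f := fun m : ℤ => q ^ (m - 1)) (fun _ => zpow_ne_zero _ hq.ne_zero) h
  rw [triPow, this, show n - 1 = m by omega]

theorem fBinom_zero_zero (q : K) : fBinom q 0 0 = 1 := by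
  simp [fBinom, qPoch_zero, invPoch_zero]

theorem sum_quadratic (hq : IsGeneric q) {L N : ℕ} (hN : L < N) (s : ℤ) :
    ∑ n ∈ Finset.range N, triPow q (L - n) * (negPoch q L / negPoch q n) * fBinom q L n *
      hermiteCoeff (q ^ 2) n s = fBinom q (2 * L) (L - s) := by
  -- The second function is the lower-order term of the recurrence with 1 - q^(2L) = (1 - q^L) (1 +
  -- q^L) absorbed into `qPoch q L` and `negPoch q L`; at L = 0 the two `invPoch` factors kill it.
  refine sum_mul_hermiteCoeff_eq_fBinom hq (hq.pow two_ne_zero)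
    (fun L n => triPow q (L - n) * (negPoch q L / negPoch q n) * fBinom q L n)
    (fun L n => (1 - q ^ (2 * L - 1 : ℤ)) * triPow q (L - 1 - n) *
      (negPoch q L / negPoch q n) * (qPoch q L * (invPoch q n * invPoch q (L - 1 - n))))
    (fun L n h => ?_) (fun L n h => ?_) ?_ (fun L n => ?_) (fun n => ?_) (fun L n => ?_) hN s
  · simp only [fBinom_of_neg q L h, mul_zero]
  · simp only [fBinom_of_lt q L h, mul_zero]
  · simp [fBinom_zero_zero, triPow, negPoch, zprod_zero]
  · have h0 := hq.ne_zero
    have h := hq.pow_succ_ne_one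
    simp only [fBinom, qPoch_succ]
    have t1 := negPoch_ne_zero hq (n - 1)
    have t2 := hq.one_add_zpow_ne_zero n
    have t3 := hq.one_add_zpow_ne_zero (n + 1)
    rw [show (L : ℤ) - (n - 1) = (L + 1 : ℕ) - n by push_cast; ring,
      show (L : ℤ) - (n + 1) = L - 1 - n by ring,
      triPow_succ hq (m := L - n) (n := (L + 1 : ℕ) - n) (by push_cast; ring),
      triPow_succ hq (m := L - 1 - n) (n := L - n) (by ring),
      negPoch_succ hq (m := L) (n := (L + 1 : ℕ)) (by push_cast; ring),
      negPoch_succ hq (m := n) (n := n + 1) (by ring),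
      negPoch_succ hq (m := n - 1) (n := n) (by ring),
      invPoch_pred h (m := n - 1) (n := n) (by ring),
      invPoch_pred h (m := n) (n := n + 1) (by ring),
      invPoch_pred h (m := L - 1 - n) (n := L - n) (by ring),
      invPoch_pred h (m := L - n) (n := (L + 1 : ℕ) - n) (by push_cast; ring)]
    push_cast
    simp only [zpow_add₀ h0, zpow_sub₀ h0, zpow_natCast, zpow_one, pow_succ, pow_mul', zpow_mul,
      zpow_ofNat, mul_comm (2 : ℤ), pow_zero, one_mul] at t2 t3 ⊢
    field_simp
    ring
  · rw [invPoch_mul_invPoch_of_neg q (by push_cast; omega)]; ring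
  · have t1 := negPoch_ne_zero hq n
    simp only [fBinom, qPoch_succ]
    rw [show ((L + 1 : ℕ) : ℤ) - 1 = L by push_cast; ring,
      negPoch_succ hq (m := L) (n := (L + 1 : ℕ)) (by push_cast; ring),
      show 2 * ((L + 1 : ℕ) : ℤ) - 1 = (2 * L + 1 : ℕ) by push_cast; ring, zpow_natCast,
      zpow_natCast]
    ring

/-- `q ^ m * (-1/q;q²)_m`, extended to integers `m`. -/
noncomputable def quarticCoeff (q : K) : ℤ → K := zprod fun m => q * (1 + q ^ (2 * m - 3))

theorem quarticCoeff_succ (hq : IsGeneric q) {m n : ℤ} (h : n = m + 1) :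
    quarticCoeff q n = q * (1 + q ^ (2 * n - 3)) * quarticCoeff q m :=
  zprod_succ (fun _ => mul_ne_zero hq.ne_zero (hq.one_add_zpow_ne_zero _)) h

theorem sum_quartic (hq : IsGeneric q) {L N : ℕ} (hN : L < N) (s : ℤ) :
    ∑ n ∈ Finset.range N, quarticCoeff q (L - n) * fBinom (q ^ 2) L n *
      hermiteCoeff (q ^ 4) n s = fBinom q (2 * L) (L - s) := by
  refine sum_mul_hermiteCoeff_eq_fBinom hq (hq.pow four_ne_zero)
    (fun L n => quarticCoeff q (L - n) * fBinom (q ^ 2) L n)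
    (fun L n => (1 - q ^ (2 * L - 1 : ℤ)) *
      quarticCoeff q (L - 1 - n) *
        (qPoch (q ^ 2) L * (invPoch (q ^ 2) n * invPoch (q ^ 2) (L - 1 - n))))
    (fun L n h => ?_) (fun L n h => ?_) ?_ (fun L n => ?_) (fun n => ?_) (fun L n => ?_) hN s
  · simp only [fBinom_of_neg _ L h, mul_zero]
  · simp only [fBinom_of_lt _ L h, mul_zero]
  · simp [fBinom_zero_zero, quarticCoeff, zprod_zero]
  · have h0 := hq.ne_zero
    have h := (hq.pow two_ne_zero).pow_succ_ne_one
    simp only [fBinom, qPoch_succ]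
    rw [show (L : ℤ) - (n - 1) = (L + 1 : ℕ) - n by push_cast; ring,
      show (L : ℤ) - (n + 1) = L - 1 - n by ring,
      quarticCoeff_succ hq (m := L - n) (n := (L + 1 : ℕ) - n) (by push_cast; ring),
      quarticCoeff_succ hq (m := L - 1 - n) (n := L - n) (by ring),
      invPoch_pred h (m := n - 1) (n := n) (by ring),
      invPoch_pred h (m := n) (n := n + 1) (by ring),
      invPoch_pred h (m := L - 1 - n) (n := L - n) (by ring),
      invPoch_pred h (m := L - n) (n := (L + 1 : ℕ) - n) (by push_cast; ring)]
    push_cast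
    simp only [show q ^ 4 = (q ^ 2) ^ 2 by ring, ← zpow_natCast (q ^ 2), ← zpow_natCast q 2,
      ← zpow_mul]
    push_cast
    simp only [mul_add, mul_sub, zpow_add₀ h0, zpow_sub₀ h0, zpow_natCast, zpow_one, pow_succ,
      pow_mul', zpow_mul, zpow_ofNat, mul_comm (2 : ℤ), pow_zero, one_mul, pow_mul]
    field_simp
    ring
  · rw [invPoch_mul_invPoch_of_neg _ (by push_cast; omega)]; ring
  · simp only [fBinom, qPoch_succ]
    rw [show ((L + 1 : ℕ) : ℤ) - 1 = L by push_cast; ring,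
      show 2 * ((L + 1 : ℕ) : ℤ) - 1 = (2 * L + 1 : ℕ) by push_cast; ring, zpow_natCast]
    ring

/-- `q ^ (m ^ 2)` for integers `m`. -/
noncomputable def sqPow (q : K) : ℤ → K := zprod fun m => q ^ (2 * m - 1)

theorem sqPow_succ (hq : IsGeneric q) {m n : ℤ} (h : n = m + 1) :
    sqPow q n = q ^ (2 * n - 1) * sqPow q m :=
  zprod_succ (f := fun m : ℤ => q ^ (2 * m - 1)) (fun _ => zpow_ne_zero _ hq.ne_zero) h

/-- With the Gaussian factor q^(s²) included, the recurrence in L becomes first order, unlike that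
of [2L, L - s] alone. -/
theorem sqPow_mul_fBinom_succ (hq : IsGeneric q) (L : ℕ) (s : ℤ) :
    sqPow q s * fBinom (q ^ 2) (2 * (L + 1)) ((L + 1 : ℕ) - s) =
      q ^ (2 * L + 1) * (sqPow q (s - 1) * fBinom (q ^ 2) (2 * L) (L - (s - 1)) +
        sqPow q (s + 1) * fBinom (q ^ 2) (2 * L) (L - (s + 1))) +
      (1 + q ^ (4 * L + 2)) * (sqPow q s * fBinom (q ^ 2) (2 * L) (L - s)) := by
  simp only [fBinom_two_mul]
  have h0 := hq.ne_zero
  have h := (hq.pow two_ne_zero).pow_succ_ne_one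
  rw [show 2 * (L + 1) = 2 * L + 1 + 1 by ring, qPoch_succ, qPoch_succ,
    sqPow_succ hq (m := s) (n := s + 1) rfl,
    sqPow_succ hq (m := s - 1) (n := s) (by ring),
    show (L : ℤ) - (s - 1) = (L + 1 : ℕ) - s by push_cast; ring,
    show (L : ℤ) + (s + 1) = (L + 1 : ℕ) + s by push_cast; ring,
    invPoch_pred h (m := L + (s - 1)) (n := L + s) (by ring),
    invPoch_pred h (m := L - (s + 1)) (n := L - s) (by ring),
    invPoch_pred h (m := L - s) (n := (L + 1 : ℕ) - s) (by push_cast; ring),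
    invPoch_pred h (m := L + s) (n := (L + 1 : ℕ) + s) (by push_cast; ring)]
  push_cast
  simp only [← zpow_natCast (q ^ 2), ← zpow_natCast q 2, ← zpow_mul]
  push_cast
  simp only [mul_add, mul_sub, zpow_add₀ h0, zpow_sub₀ h0, zpow_natCast, zpow_one, pow_succ,
    pow_mul', zpow_mul, zpow_ofNat, mul_comm (2 : ℤ), pow_zero, one_mul, pow_mul, mul_one]
  field_simp
  ring

/-- This is `sum_quadratic` under q → 1/q. It is stated in base q² because the inversion produces
the half-integral powers q^(n²/2) and q^(s²/2). The proof does not invert q but runs the recurrence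
argument again. -/
theorem sum_quadratic_dual (hq : IsGeneric q) {L N : ℕ} (hN : L < N) (s : ℤ) :
    ∑ n ∈ Finset.range N, sqPow q n * (negPoch (q ^ 2) L / negPoch (q ^ 2) n) * fBinom (q ^ 2) L n *
      hermiteCoeff (q ^ 4) n s = sqPow q s * fBinom (q ^ 2) (2 * L) (L - s) := by
  have h4 := hq.pow (p := 4) four_ne_zero
  have hC : ∀ L n : ℕ, sqPow q n * (negPoch (q ^ 2) (L + 1 : ℕ) / negPoch (q ^ 2) n) * fBinom (q ^ 2) (L + 1) n =
      q ^ (2 * L + 1) * (sqPow q (n - 1) * (negPoch (q ^ 2) L / negPoch (q ^ 2) (n - 1)) *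
          fBinom (q ^ 2) L (n - 1) +
        (1 - (q ^ 4) ^ (n + 1)) * (sqPow q (n + 1) * (negPoch (q ^ 2) L / negPoch (q ^ 2) (n + 1)) *
          fBinom (q ^ 2) L (n + 1))) +
      (1 + q ^ (4 * L + 2)) * (sqPow q n * (negPoch (q ^ 2) L / negPoch (q ^ 2) n) * fBinom (q ^ 2) L n) := by
    intro L n
    have h0 := hq.ne_zero
    have h2 := hq.pow two_ne_zero
    have h := h2.pow_succ_ne_one
    have t1 := negPoch_ne_zero h2 (n - 1)
    have t2 := h2.one_add_zpow_ne_zero n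
    have t3 := h2.one_add_zpow_ne_zero (n + 1)
    simp only [fBinom, qPoch_succ]
    rw [show (L : ℤ) - (n - 1) = (L + 1 : ℕ) - n by push_cast; ring,
      show (L : ℤ) - (n + 1) = L - 1 - n by ring,
      sqPow_succ hq (m := n) (n := n + 1) (by ring),
      sqPow_succ hq (m := n - 1) (n := n) (by ring),
      negPoch_succ h2 (m := L) (n := (L + 1 : ℕ)) (by push_cast; ring),
      negPoch_succ h2 (m := n) (n := n + 1) (by ring),
      negPoch_succ h2 (m := n - 1) (n := n) (by ring),
      invPoch_pred h (m := n - 1) (n := n) (by ring),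
      invPoch_pred h (m := n) (n := n + 1) (by ring),
      invPoch_pred h (m := L - 1 - n) (n := L - n) (by ring),
      invPoch_pred h (m := L - n) (n := (L + 1 : ℕ) - n) (by push_cast; ring)]
    push_cast
    simp only [show q ^ 4 = (q ^ 2) ^ 2 by ring, ← zpow_natCast (q ^ 2), ← zpow_natCast q 2,
      ← zpow_mul] at t2 t3 ⊢
    push_cast at t2 t3 ⊢
    simp only [mul_add, mul_sub, zpow_add₀ h0, zpow_sub₀ h0, zpow_natCast, zpow_one, pow_succ,
      pow_mul', zpow_mul, zpow_ofNat, mul_comm (2 : ℤ), pow_zero, one_mul, pow_mul, mul_one] at t2 t3 ⊢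
    have hy : q ^ n ≠ 0 := pow_ne_zero _ h0
    simp only [mul_pow]
    generalize q ^ n = y at t2 t3 hy ⊢
    generalize q ^ L = x
    have t4 : 1 + y ^ 2 ≠ 0 := by rwa [sq]
    have t5 : 1 + y ^ 2 * q ^ 2 ≠ 0 := by rwa [← mul_pow, sq]
    field_simp
    ring
  refine sum_mul_eq_of_recurrence (hermiteCoeff (q ^ 4)) (fun n => 1 - (q ^ 4) ^ n)
    (hermiteCoeff_zero h4.pow_succ_ne_one)
    (hermiteCoeff_succ h4.pow_succ_ne_one h4.ne_zero)
    (fun L s => sqPow q s * fBinom (q ^ 2) (2 * L) (L - s))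
    (fun L => q ^ (2 * L + 1)) (fun L => 1 + q ^ (4 * L + 2)) (fun _ => 0) (fun s => ?_)
    (fun s => sqPow_mul_fBinom_succ hq 0 s)
    (fun L s => ?_)
    (fun L n => sqPow q n * (negPoch (q ^ 2) L / negPoch (q ^ 2) n) * fBinom (q ^ 2) L n)
    (fun L n h => ?_) (fun L n h => ?_) ?_ (fun n => hC 0 n) (fun L n => ?_) L N hN s
  · rw [← fBinom_zero_eq_hermiteCoeff (q ^ 2)]
    rcases eq_or_ne s 0 with rfl | hs
    · simp [sqPow, zprod_zero]
    · have : fBinom (q ^ 2) (2 * 0) ((0 : ℕ) - s) = 0 := by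
        rcases lt_or_gt_of_ne hs with h | h
        · exact fBinom_of_lt _ _ (by push_cast; omega)
        · exact fBinom_of_neg _ _ (by push_cast; omega)
      rw [this, mul_zero]
  · rw [zero_mul, add_zero]; exact sqPow_mul_fBinom_succ hq (L + 1) s
  · simp only [fBinom_of_neg _ L h, mul_zero]
  · simp only [fBinom_of_lt _ L h, mul_zero]
  · simp [fBinom_zero_zero, negPoch, sqPow, zprod_zero]
  · rw [zero_mul, add_zero]; exact hC (L + 1) n

end Recurrence

/-! ### The self-dual quadratic summation by a WZ pair -/

section Summation

variable {K : Type*} [Field K] {q : K}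

theorem sqPow_eq (hq : IsGeneric q) (m : ℤ) : sqPow q m = q ^ (m * m) := by
  have h0 := hq.ne_zero
  induction m using Int.induction_on with
  | zero => simp [sqPow, zprod_zero]
  | succ i ih =>
    rw [sqPow_succ hq (m := i) rfl, ih, ← zpow_add₀ h0]; congr 1; ring
  | pred i ih =>
    have := sqPow_succ hq (m := -(i : ℤ) - 1) (n := -i) (by ring)
    rw [ih] at this
    refine mul_left_cancel₀ (zpow_ne_zero (2 * -(i : ℤ) - 1) h0) ?_
    rw [← this, ← zpow_add₀ h0]; congr 1; ring

theorem triPow_neg (hq : IsGeneric q) (m : ℤ) : triPow q (-m) = q ^ m * triPow q m := by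
  have h0 := hq.ne_zero
  induction m using Int.induction_on with
  | zero => simp
  | succ i ih =>
    have := triPow_succ hq (m := -((i : ℤ) + 1)) (n := -i) (by ring)
    rw [ih] at this
    refine mul_left_cancel₀ (zpow_ne_zero (-((i : ℤ) + 1)) h0) ?_
    rw [← this, triPow_succ hq (m := i) (n := i + 1) rfl, ← mul_assoc, ← mul_assoc, ← zpow_add₀ h0,
      ← zpow_add₀ h0]
    congr 2; ring
  | pred i ih =>
    have := triPow_succ hq (m := -(i : ℤ) - 1) (n := -i) (by ring)
    rw [this] at ih
    rw [triPow_succ hq (m := - -(i : ℤ)) (n := -(-(i : ℤ) - 1)) (by ring), ih, ← mul_assoc,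
      ← mul_assoc, ← zpow_add₀ h0, ← zpow_add₀ h0]
    congr 2; ring

theorem triPow_natCast (hq : IsGeneric q) (n : ℕ) : triPow q n = q ^ (n * (n - 1) / 2) := by
  induction n with
  | zero => simp [triPow, zprod_zero]
  | succ n ih =>
    rw [triPow_succ hq (m := n) (by push_cast; ring), ih, zpow_natCast, ← pow_add]
    congr 1
    rcases n with _ | n
    · rfl
    · rw [Nat.add_sub_cancel, Nat.add_sub_cancel,
        show (n + 1 + 1) * (n + 1) = (n + 1) * n + (n + 1) * 2 by ring,
        Nat.add_mul_div_right _ _ two_pos]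
      ring

theorem fBinom_zero_right (hq : IsGeneric q) (n : ℕ) : fBinom q n 0 = 1 := by
  rw [fBinom, invPoch_zero, sub_zero, invPoch_natCast, mul_one,
    mul_inv_cancel₀ (qPoch_ne_zero hq.pow_succ_ne_one n)]

theorem fBinom_symm (q : K) (n : ℕ) (k : ℤ) : fBinom q n (n - k) = fBinom q n k := by
  rw [fBinom, fBinom, sub_sub_cancel]; ring

theorem fBinom_self (hq : IsGeneric q) (n : ℕ) : fBinom q n n = 1 := by
  rw [← fBinom_symm, sub_self, fBinom_zero_right hq]

theorem invPoch_sub_mul_invPoch_add (q : K) {r : ℕ} {j : ℤ} (h : r < j.natAbs) :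
    invPoch q (r - j) * invPoch q (r + j) = 0 := by
  rcases lt_or_ge j 0 with hj | hj
  · rw [invPoch_of_neg q (n := r + j) (by omega), mul_zero]
  · rw [invPoch_of_neg q (n := r - j) (by omega), zero_mul]

/-- Summand for the positivity-preserving transformation with factor `q ^ (j ^ 2)`. -/
noncomputable def selfDualTerm (q : K) (L : ℕ) (j : ℤ) (r : ℕ) : K :=
  sqPow q r * ((1 + q ^ L) * negPoch (q ^ 2) (L - r - 1) / negPoch (q ^ 2) r) *
    fBinom q L (2 * r) * fBinom (q ^ 2) (2 * r) (r - j)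

/-- The common factor of the terms in `selfDualTerm_wz`. -/
noncomputable def selfDualBase (q : K) (L : ℕ) (j : ℤ) (r : ℕ) : K :=
  sqPow q r * negPoch (q ^ 2) (L - r - 1) / negPoch (q ^ 2) r * qPoch q L *
    (invPoch q (2 * r + 2) * invPoch q (L + 1 - 2 * r)) *
    (qPoch (q ^ 2) (2 * r) *
    invPoch (q ^ 2) (r + 1 - j) * invPoch (q ^ 2) (r + 1 + j))

/-- In `selfDualBase` every `invPoch` has the largest argument occurring in the WZ relation, so this
term and the two after it are the base times elementary factors, and the relation reduces to an
algebraic identity in q, q^L, q^r, q^j. -/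
theorem selfDualTerm_eq_base (hq : IsGeneric q) (L : ℕ) (j : ℤ) (r : ℕ) :
    selfDualTerm q L j r = selfDualBase q L j r * ((1 + q ^ L) * (1 - q ^ (2 * r + 1)) *
      (1 - q ^ (2 * r + 2)) * (1 - q ^ (L + 1 - 2 * r : ℤ)) * (1 - (q ^ 2) ^ (r + 1 - j : ℤ)) *
      (1 - (q ^ 2) ^ (r + 1 + j : ℤ))) := by
  have h := hq.pow_succ_ne_one
  have h' := (hq.pow two_ne_zero).pow_succ_ne_one
  rw [selfDualTerm, fBinom_two_mul, fBinom, selfDualBase,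
    invPoch_pred h (m := 2 * r) (n := 2 * r + 1) (by ring),
    invPoch_pred h (m := 2 * r + 1) (n := 2 * r + 2) (by ring),
    invPoch_pred h (m := L - 2 * r) (n := L + 1 - 2 * r) (by ring),
    invPoch_pred h' (m := r - j) (n := r + 1 - j) (by ring),
    invPoch_pred h' (m := r + j) (n := r + 1 + j) (by ring),
    show (2 * r + 1 : ℤ) = (2 * r + 1 : ℕ) by push_cast; ring,
    show (2 * r + 2 : ℤ) = (2 * r + 2 : ℕ) by push_cast; ring, zpow_natCast, zpow_natCast]
  ring

theorem selfDualTerm_succ_left_eq_base (hq : IsGeneric q) (L : ℕ) (j : ℤ) (r : ℕ) :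
    selfDualTerm q (L + 1) j r = selfDualBase q L j r * ((1 + q ^ (L + 1)) *
      (1 + (q ^ 2) ^ (L - r : ℤ)) * (1 - q ^ (L + 1)) * (1 - q ^ (2 * r + 1)) *
      (1 - q ^ (2 * r + 2)) * (1 - (q ^ 2) ^ (r + 1 - j : ℤ)) *
      (1 - (q ^ 2) ^ (r + 1 + j : ℤ))) := by
  have h := hq.pow_succ_ne_one
  have h2 := hq.pow two_ne_zero
  have h' := h2.pow_succ_ne_one
  rw [selfDualTerm, fBinom_two_mul, fBinom, selfDualBase, qPoch_succ,
    show ((L + 1 : ℕ) : ℤ) - r - 1 = L - r by push_cast; ring,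
    show ((L + 1 : ℕ) : ℤ) - 2 * r = L + 1 - 2 * r by push_cast; ring,
    negPoch_succ h2 (m := L - r - 1) (n := L - r) (by ring),
    invPoch_pred h (m := 2 * r) (n := 2 * r + 1) (by ring),
    invPoch_pred h (m := 2 * r + 1) (n := 2 * r + 2) (by ring),
    invPoch_pred h' (m := r - j) (n := r + 1 - j) (by ring),
    invPoch_pred h' (m := r + j) (n := r + 1 + j) (by ring),
    show (2 * r + 1 : ℤ) = (2 * r + 1 : ℕ) by push_cast; ring,
    show (2 * r + 2 : ℤ) = (2 * r + 2 : ℕ) by push_cast; ring, zpow_natCast, zpow_natCast]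
  ring

theorem selfDualTerm_succ_succ_eq_base (hq : IsGeneric q) (L : ℕ) (j : ℤ) (r : ℕ) :
    selfDualTerm q (L + 1) j (r + 1) = selfDualBase q L j r * (q ^ (2 * r + 1) *
      (1 + q ^ (L + 1)) * (1 - q ^ (L + 1)) * (1 - q ^ (L - 2 * r : ℤ)) *
      (1 - q ^ (L + 1 - 2 * r : ℤ)) * (1 - (q ^ 2) ^ (2 * r + 1)) * (1 - (q ^ 2) ^ (r + 1))) := by
  have h := hq.pow_succ_ne_one
  have h2 := hq.pow two_ne_zero
  have t1 : 1 + (q ^ 2) ^ (r + 1) ≠ 0 := by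
    have := h2.one_add_zpow_ne_zero ((r + 1 : ℕ) : ℤ)
    rwa [zpow_natCast] at this
  have e : 1 - (q ^ 2) ^ (2 * r + 1 + 1) = (1 - (q ^ 2) ^ (r + 1)) * (1 + (q ^ 2) ^ (r + 1)) := by
    ring
  rw [selfDualTerm, fBinom_two_mul, fBinom, selfDualBase, qPoch_succ,
    show 2 * (r + 1) = 2 * r + 1 + 1 by ring, qPoch_succ, qPoch_succ, e,
    sqPow_succ hq (m := r) (n := (r + 1 : ℕ)) (by push_cast; ring),
    negPoch_succ h2 (m := r) (n := (r + 1 : ℕ)) (by push_cast; ring),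
    show ((L + 1 : ℕ) : ℤ) - (r + 1 : ℕ) - 1 = L - r - 1 by push_cast; ring,
    show 2 * ((r + 1 : ℕ) : ℤ) = 2 * r + 2 by push_cast; ring,
    show ((L + 1 : ℕ) : ℤ) - (2 * r + 2) = L - 2 * r - 1 by push_cast; ring,
    invPoch_pred h (m := L - 2 * r - 1) (n := L - 2 * r) (by ring),
    invPoch_pred h (m := L - 2 * r) (n := L + 1 - 2 * r) (by ring),
    show (2 * r + 2 - 1 : ℤ) = (2 * r + 1 : ℕ) by push_cast; ring, zpow_natCast, zpow_natCast,
    Nat.cast_succ]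
  generalize 1 + (q ^ 2) ^ (r + 1) = D at t1 ⊢
  refine Eq.trans ?_ ((congrArg _ (mul_inv_cancel₀ t1)).trans (mul_one _))
  simp only [div_eq_mul_inv, mul_inv]
  ring

/-- Summed over r the right side telescopes, giving a first-order recurrence in L, the same one that
[2L, L - 2j] satisfies. -/
theorem selfDualTerm_wz (hq : IsGeneric q) (L : ℕ) (j : ℤ) (r : ℕ) :
    (1 - q ^ (L + 1 - 2 * j)) * (1 - q ^ (L + 1 + 2 * j)) * selfDualTerm q (L + 1) j r -
      (1 - q ^ (2 * L + 1)) * (1 - q ^ (2 * L + 2)) * selfDualTerm q L j r =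
    -(q ^ (L + 1 - 2 * (r + 1) : ℤ) * (1 - q ^ (2 * (r + 1) - 2 * j)) *
      (1 - q ^ (2 * (r + 1) + 2 * j)) * selfDualTerm q (L + 1) j (r + 1)) -
    -(q ^ (L + 1 - 2 * r : ℤ) * (1 - q ^ (2 * r - 2 * j)) * (1 - q ^ (2 * r + 2 * j)) *
      selfDualTerm q (L + 1) j r) := by
  have h0 := hq.ne_zero
  rw [selfDualTerm_succ_succ_eq_base hq, selfDualTerm_succ_left_eq_base hq L j r,
    selfDualTerm_eq_base hq L j r]
  simp only [← zpow_natCast (q ^ 2), ← zpow_natCast q 2, ← zpow_mul]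
  push_cast
  simp only [mul_add, mul_sub, zpow_add₀ h0, zpow_sub₀ h0, zpow_natCast, zpow_one, pow_succ,
    pow_mul', zpow_mul, zpow_ofNat, mul_comm (2 : ℤ), pow_zero, one_mul, pow_mul, mul_one]
  have hy : q ^ r ≠ 0 := pow_ne_zero _ h0
  have hw : q ^ j ≠ 0 := zpow_ne_zero _ h0
  have hx : q ^ L ≠ 0 := pow_ne_zero _ h0
  simp only [mul_pow]
  generalize selfDualBase q L j r = T
  generalize q ^ r = y at hy ⊢
  generalize q ^ j = w at hw ⊢
  generalize q ^ L = x at hx ⊢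
  field_simp
  ring

theorem sum_selfDualTerm (hq : IsGeneric q) (j : ℤ) (L : ℕ) : ∀ {N : ℕ}, L < N →
    ∑ r ∈ Finset.range N, selfDualTerm q L j r = sqPow q j * fBinom q (2 * L) (L - 2 * j) := by
  have h2 := hq.pow two_ne_zero
  -- The recurrence is useless when L + 1 = 2|j|, since its leading factor vanishes. For L ≤ 2|j|
  -- only r = |j| can contribute, because [2r, r - j] needs r ≥ |j| and [L, 2r] needs 2r ≤ L.
  have small : ∀ L N : ℕ, L < N → L ≤ 2 * j.natAbs →
      ∑ r ∈ Finset.range N, selfDualTerm q L j r = sqPow q j * fBinom q (2 * L) (L - 2 * j) := by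
    intro L N hN hL
    have hz : ∀ r : ℕ, r ≠ j.natAbs → selfDualTerm q L j r = 0 := by
      intro r hr
      rw [selfDualTerm]
      rcases lt_or_gt_of_ne hr with h | h
      · rw [fBinom_two_mul, mul_assoc (qPoch _ _), invPoch_sub_mul_invPoch_add _ h]; ring
      · rw [fBinom_of_lt q L (by omega)]; ring
    rw [Finset.sum_eq_single j.natAbs (fun r _ hr => hz r hr)
      (fun hr => by
        rw [selfDualTerm, fBinom_of_lt q L (by simp only [Finset.mem_range] at hr; omega)]; ring)]
    rcases hL.lt_or_eq with hL | rfl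
    · rw [selfDualTerm, fBinom_of_lt q L (by omega)]
      rcases lt_or_ge j 0 with hj | hj
      · rw [fBinom_of_lt q _ (by push_cast; omega)]; ring
      · rw [fBinom_of_neg q _ (by omega)]; ring
    · have e : sqPow q j.natAbs = sqPow q j := by
        rw [sqPow_eq hq, sqPow_eq hq, Int.natAbs_mul_self']
      -- The factor 1 + q^L with L = 2|j| completes the shorter product, so the quotient is 1. For j
      -- = 0 this uses the two-sided extension, in which `negPoch _ (-1)` is 1/2.
      have e1 := negPoch_succ h2 (m := j.natAbs - 1) (n := j.natAbs) (by ring)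
      have e2 := negPoch_ne_zero h2 (j.natAbs)
      rw [selfDualTerm, e, show ((2 * j.natAbs : ℕ) : ℤ) - j.natAbs - 1 = j.natAbs - 1 by
        push_cast; ring, show (2 * (j.natAbs : ℤ)) = (2 * j.natAbs : ℕ) by push_cast; ring,
        fBinom_self hq, pow_mul q 2 j.natAbs, ← zpow_natCast (q ^ 2) j.natAbs, ← e1, div_self e2]
      rcases lt_or_ge j 0 with hj | hj
      · rw [show (j.natAbs : ℤ) - j = (2 * j.natAbs : ℕ) by omega,
          show ((2 * j.natAbs : ℕ) : ℤ) - 2 * j = (2 * (2 * j.natAbs) : ℕ) by omega,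
          fBinom_self hq, fBinom_self h2]
        ring
      · rw [show (j.natAbs : ℤ) - j = 0 by omega,
          show ((2 * j.natAbs : ℕ) : ℤ) - 2 * j = 0 by omega,
          fBinom_zero_right hq, fBinom_zero_right h2]
        ring
  induction L with
  | zero => exact fun hN => small 0 _ hN (Nat.zero_le _)
  | succ L ih =>
    intro N hN
    by_cases hL : L + 1 ≤ 2 * j.natAbs
    · exact small _ _ hN hL
    have key := Finset.sum_range_sub (fun r : ℕ => -(q ^ (L + 1 - 2 * r : ℤ) *
      (1 - q ^ (2 * r - 2 * j)) * (1 - q ^ (2 * r + 2 * j)) * selfDualTerm q (L + 1) j r)) N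
    have e : ∀ r : ℕ, (2 * (r + 1) : ℤ) = 2 * (r + 1 : ℕ) := fun r => by push_cast; ring
    rw [Finset.sum_congr rfl fun r _ => by
      rw [← e r, ← selfDualTerm_wz hq], Finset.sum_sub_distrib, ← Finset.mul_sum,
      ← Finset.mul_sum, ih (by omega)] at key
    have z1 : selfDualTerm q (L + 1) j N = 0 := by
      rw [selfDualTerm, fBinom_of_lt q _ (by push_cast; omega)]; ring
    have z2 : (1 - q ^ (2 * ((0 : ℕ) : ℤ) - 2 * j)) * selfDualTerm q (L + 1) j 0 = 0 := by
      rcases eq_or_ne j 0 with rfl | hj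
      · simp
      · rw [selfDualTerm, fBinom_two_mul, mul_assoc (qPoch _ _),
          invPoch_sub_mul_invPoch_add _ (by omega)]
        ring
    have z4 : -(q ^ (L + 1 - 2 * (0 : ℕ) : ℤ) * (1 - q ^ (2 * ((0 : ℕ) : ℤ) - 2 * j)) *
        (1 - q ^ (2 * ((0 : ℕ) : ℤ) + 2 * j)) * selfDualTerm q (L + 1) j 0) = 0 := by
      linear_combination (-q ^ (L + 1 - 2 * (0 : ℕ) : ℤ) *
        (1 - q ^ (2 * ((0 : ℕ) : ℤ) + 2 * j))) * z2
    rw [z1, mul_zero, neg_zero, z4] at key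
    have h := hq.pow_succ_ne_one
    have f1 : (1 - q ^ (L + 1 - 2 * j)) ≠ 0 :=
      sub_ne_zero.mpr (hq.zpow_ne_one _ (by omega)).symm
    have f2 : (1 - q ^ (L + 1 + 2 * j)) ≠ 0 :=
      sub_ne_zero.mpr (hq.zpow_ne_one _ (by omega)).symm
    refine mul_left_cancel₀ (mul_ne_zero f1 f2) ?_
    rw [fBinom_two_mul, show 2 * (L + 1) = 2 * L + 1 + 1 by ring, qPoch_succ, qPoch_succ]
    rw [fBinom_two_mul,
      invPoch_pred h (m := L - 2 * j) (n := (L + 1 : ℕ) - 2 * j) (by push_cast; ring),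
      invPoch_pred h (m := L + 2 * j) (n := (L + 1 : ℕ) + 2 * j) (by push_cast; ring)] at key
    push_cast at key ⊢
    linear_combination key

end Summation

/-! ### q-Vandermonde and q-Pfaff–Saalschütz sums -/

section Vandermonde

variable {K : Type*} [Field K] {q : K}

theorem pow_succ_mul_succ_add (q : K) (t d : ℕ) :
    q ^ ((t + 1) * (t + 1 + d)) = q ^ (t * (t + d)) * q ^ (2 * t + 1 + d) := by
  rw [← pow_add]; congr 1; ring

theorem one_sub_pow_succ_ne_zero (hq : IsGeneric q) (n : ℕ) : 1 - q ^ (n + 1) ≠ 0 :=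
  sub_ne_zero.mpr (hq.pow_succ_ne_one n).symm

/-- The `q`-Vandermonde sum. -/
theorem sum_vandermonde (hq : IsGeneric q) (A C d : ℕ) :
    ∑ t ∈ Finset.range (C + 1), q ^ (t * (t + d)) * fBinom q A t * fBinom q C (t + d) =
      fBinom q (A + C) (A + d) := by
  have h0 := hq.ne_zero
  have h := hq.pow_succ_ne_one
  induction A with
  | zero =>
    rw [Finset.sum_range_succ', Finset.sum_eq_zero fun t _ => by
      rw [fBinom_of_lt q 0 (by omega)]; ring]
    simp [fBinom_zero_zero]
  | succ A ih =>
    -- WZ certificate for the recurrence in A. It is written with `invPoch q (A + 1 - t)` so that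
    -- nothing has to be divided by 1 - q^(A+1-t).
    have key := Finset.sum_range_sub (fun t : ℕ => -(q ^ (A + 1 - t : ℤ) * (1 - q ^ t) *
      (1 - q ^ (t + d)) * (qPoch q A * invPoch q t * invPoch q (A + 1 - t)) *
      q ^ (t * (t + d)) * fBinom q C (t + d))) (C + 1)
    have wz : ∀ t : ℕ, (1 - q ^ (A + 1 + d)) *
        (q ^ (t * (t + d)) * fBinom q (A + 1) t * fBinom q C (t + d)) -
        (1 - q ^ (A + C + 1)) * (q ^ (t * (t + d)) * fBinom q A t * fBinom q C (t + d)) =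
      -(q ^ (A + 1 - (t + 1 : ℕ) : ℤ) * (1 - q ^ (t + 1)) *
      (1 - q ^ (t + 1 + d)) * (qPoch q A * invPoch q (t + 1 : ℕ) * invPoch q (A + 1 - (t + 1 : ℕ))) *
      q ^ ((t + 1) * (t + 1 + d)) * fBinom q C ((t + 1 : ℕ) + d)) - -(q ^ (A + 1 - t : ℤ) * (1 - q ^ t) *
      (1 - q ^ (t + d)) * (qPoch q A * invPoch q t * invPoch q (A + 1 - t)) *
      q ^ (t * (t + d)) * fBinom q C (t + d)) := by
      intro t
      rw [pow_succ_mul_succ_add]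
      simp only [fBinom, qPoch_succ]
      rw [show (A : ℤ) + 1 - (t + 1 : ℕ) = A - t by push_cast; ring,
        show ((A + 1 : ℕ) : ℤ) - t = A + 1 - t by push_cast; ring,
        show ((t + 1 : ℕ) : ℤ) + d = t + d + 1 by push_cast; ring,
        show (C : ℤ) - (t + d + 1) = C - (t + d) - 1 by ring,
        invPoch_pred h (m := C - (t + d) - 1) (n := C - (t + d)) rfl,
        invPoch_pred h (m := t) (n := (t + 1 : ℕ)) (by push_cast; ring),
        invPoch_pred h (m := t + d) (n := t + d + 1) (by ring),
        invPoch_pred h (m := A - t) (n := A + 1 - t) (by ring)]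
      generalize q ^ (t * (t + d)) = T
      push_cast
      generalize invPoch q (t + 1) = a1
      generalize invPoch q (t + d + 1) = a2
      generalize invPoch q (A + 1 - t) = a3
      generalize invPoch q (C - (t + d)) = a4
      simp only [zpow_add₀ h0, zpow_sub₀ h0, zpow_natCast, zpow_one, pow_succ, pow_add, pow_mul',
        pow_zero, one_mul]
      have hy : q ^ t ≠ 0 := pow_ne_zero _ h0
      have hd : q ^ d ≠ 0 := pow_ne_zero _ h0
      generalize q ^ t = y at hy ⊢
      generalize q ^ d = w at hd ⊢
      generalize q ^ A = x
      generalize q ^ C = z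
      field_simp
      ring
    rw [Finset.sum_congr rfl fun t _ => (wz t).symm, Finset.sum_sub_distrib, ← Finset.mul_sum,
      ← Finset.mul_sum, ih] at key
    have z1 : fBinom q C ((C + 1 : ℕ) + d) = 0 := fBinom_of_lt q C (by push_cast; omega)
    rw [z1, mul_zero, neg_zero, pow_zero, sub_self (1 : K), mul_zero, zero_mul, zero_mul, zero_mul,
      zero_mul, neg_zero, sub_zero, sub_eq_zero] at key
    have e := one_sub_pow_succ_ne_zero hq (A + d)
    rw [show A + d + 1 = A + 1 + d by ring] at e
    refine mul_left_cancel₀ e ?_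
    rw [key, fBinom, fBinom, show A + 1 + C = A + C + 1 by ring, qPoch_succ,
      invPoch_pred h (m := A + d) (n := (A + 1 : ℕ) + d) (by push_cast; ring),
      show ((A + C : ℕ) : ℤ) - (A + d) = C - d by push_cast; ring,
      show ((A + C + 1 : ℕ) : ℤ) - ((A + 1 : ℕ) + d) = C - d by push_cast; ring,
      show ((A + 1 : ℕ) : ℤ) + d = (A + 1 + d : ℕ) by push_cast; ring, zpow_natCast]
    ring

/-- The WZ relation for `sum_saalschutz` after its common factors are removed, with x = q^A, z =
q^C, u = q^m, y = q^t, w = q^d. -/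
theorem saalschutz_aux {x z u w y : K} (hy : y ≠ 0) (hw : w ≠ 0) :
    (1 - u * q) * (1 - u * q * w) * (1 - x * z * u * q / y) -
      (1 - x * w * u * q) * (1 - z * u * q) * (1 - u * q / y) =
    -(u / y * (y * y * q * w) * (1 - x / y) * (1 - z / (y * w)) * (1 - u * q / y)) +
      u * q / y * (1 - y) * (1 - y * w) * (1 - x * z * u * q / y) := by
  field_simp
  ring

/-- The `q`-Pfaff–Saalschütz sum. -/
theorem sum_saalschutz (hq : IsGeneric q) (A C d m : ℕ) :
    ∑ t ∈ Finset.range (A + 1), q ^ (t * (t + d)) * fBinom q A t * fBinom q C (t + d) *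
        fBinom q (A + C + m - t) (A + C) =
      fBinom q (A + d + m) m * fBinom q (C + m) (m + d) := by
  have h0 := hq.ne_zero
  have h := hq.pow_succ_ne_one
  have conv : ∀ m t : ℕ, t ∈ Finset.range (A + 1) → fBinom q (A + C + m - t) (A + C) =
      qPoch q (A + C + m - t) * invPoch q (A + C) * invPoch q (m - t) := by
    intro m t ht
    rw [Finset.mem_range] at ht
    rw [fBinom, Nat.cast_sub (by omega)]
    congr 2; push_cast; ring
  induction m with
  | zero =>
    rw [Finset.sum_range_succ', Finset.sum_eq_zero fun t ht => by
      rw [conv 0 (t + 1) (by simp only [Finset.mem_range] at ht ⊢; omega),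
        invPoch_of_neg q (n := (0 : ℕ) - (t + 1 : ℕ)) (by push_cast; omega)]; ring]
    have := fBinom_self hq (A + C)
    push_cast at this
    simp [fBinom_zero_right hq, this]
  | succ m ih =>
    -- WZ certificate for the recurrence in m; A, C and d stay fixed.
    have key := Finset.sum_range_sub (fun t : ℕ => -(q ^ (m + 1 - t : ℤ) * (1 - q ^ t) *
      (1 - q ^ (t + d)) * (q ^ (t * (t + d)) * fBinom q A t * fBinom q C (t + d) *
      (qPoch q (A + C + (m + 1) - t) * invPoch q (A + C) * invPoch q (m + 1 - t))))) (A + 1)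
    have wz : ∀ t ∈ Finset.range (A + 1), (1 - q ^ (m + 1)) * (1 - q ^ (m + 1 + d)) *
        (q ^ (t * (t + d)) * fBinom q A t * fBinom q C (t + d) *
          fBinom q (A + C + (m + 1) - t) (A + C)) -
        (1 - q ^ (A + d + m + 1)) * (1 - q ^ (C + m + 1)) *
        (q ^ (t * (t + d)) * fBinom q A t * fBinom q C (t + d) *
          fBinom q (A + C + m - t) (A + C)) =
      -(q ^ (m + 1 - (t + 1 : ℕ) : ℤ) * (1 - q ^ (t + 1)) *
      (1 - q ^ (t + 1 + d)) * (q ^ ((t + 1) * (t + 1 + d)) * fBinom q A (t + 1 : ℕ) *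
        fBinom q C ((t + 1 : ℕ) + d) *
      (qPoch q (A + C + (m + 1) - (t + 1)) * invPoch q (A + C) * invPoch q (m + 1 - (t + 1 : ℕ))))) -
      -(q ^ (m + 1 - t : ℤ) * (1 - q ^ t) *
      (1 - q ^ (t + d)) * (q ^ (t * (t + d)) * fBinom q A t * fBinom q C (t + d) *
      (qPoch q (A + C + (m + 1) - t) * invPoch q (A + C) * invPoch q (m + 1 - t)))) := by
      intro t ht
      rw [conv m t ht, conv (m + 1) t ht]
      rw [Finset.mem_range] at ht
      have e : (q : K) ^ (A + C + m - t + 1) = q ^ (A + C + m + 1 - t : ℤ) := by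
        rw [← zpow_natCast]; congr 1; push_cast [Nat.cast_sub (show t ≤ A + C + m by omega)]; ring
      rw [show A + C + (m + 1) - (t + 1) = A + C + m - t by omega,
        show A + C + (m + 1) - t = A + C + m - t + 1 by omega, qPoch_succ, e,
        pow_succ_mul_succ_add]
      simp only [fBinom]
      rw [show (m : ℤ) + 1 - (t + 1 : ℕ) = m - t by push_cast; ring,
        show ((m + 1 : ℕ) : ℤ) - t = m + 1 - t by push_cast; ring,
        show ((t + 1 : ℕ) : ℤ) + d = t + d + 1 by push_cast; ring,
        show (C : ℤ) - (t + d + 1) = C - (t + d) - 1 by ring,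
        show (A : ℤ) - (t + 1 : ℕ) = A - t - 1 by push_cast; ring,
        invPoch_pred h (m := C - (t + d) - 1) (n := C - (t + d)) rfl,
        invPoch_pred h (m := A - t - 1) (n := A - t) rfl,
        invPoch_pred h (m := t) (n := (t + 1 : ℕ)) (by push_cast; ring),
        invPoch_pred h (m := t + d) (n := t + d + 1) (by ring),
        invPoch_pred h (m := m - t) (n := m + 1 - t) (by ring)]
      have hy : q ^ t ≠ 0 := pow_ne_zero _ h0
      have hd : q ^ d ≠ 0 := pow_ne_zero _ h0
      have alg := saalschutz_aux (q := q) (x := q ^ A) (z := q ^ C) (u := q ^ m) hy hd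
      push_cast
      simp only [zpow_add₀ h0, zpow_sub₀ h0, zpow_natCast, zpow_one, pow_succ, pow_add, pow_mul',
        pow_zero, one_mul]
      linear_combination (q ^ (t * (t + d)) * qPoch q A * invPoch q (t + 1) * invPoch q (A - t) *
        qPoch q C * invPoch q (t + d + 1) * invPoch q (C - (t + d)) * qPoch q (A + C + m - t) *
        invPoch q (A + C) * invPoch q (m + 1 - t) * (1 - q ^ t * q) * (1 - q ^ t * q ^ d * q)) * alg
    rw [Finset.sum_congr rfl fun t ht => (wz t ht).symm, Finset.sum_sub_distrib, ← Finset.mul_sum,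
      ← Finset.mul_sum, ih] at key
    have z1 : fBinom q A (A + 1 : ℕ) = 0 := fBinom_of_lt q A (by push_cast; omega)
    rw [z1, pow_zero, sub_self (1 : K)] at key
    simp only [mul_zero, zero_mul, neg_zero, sub_zero, sub_eq_zero] at key
    have e := one_sub_pow_succ_ne_zero hq (m + d)
    rw [show m + d + 1 = m + 1 + d by ring] at e
    refine mul_left_cancel₀ (mul_ne_zero (one_sub_pow_succ_ne_zero hq m) e) ?_
    rw [key]
    simp only [fBinom]
    rw [show A + d + (m + 1) = A + d + m + 1 by ring, show C + (m + 1) = C + m + 1 by ring,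
      qPoch_succ, qPoch_succ,
      invPoch_pred h (m := m) (n := (m + 1 : ℕ)) (by push_cast; ring),
      invPoch_pred h (m := m + d) (n := (m + 1 : ℕ) + d) (by push_cast; ring),
      show ((A + d + m + 1 : ℕ) : ℤ) - (m + 1 : ℕ) = A + d by push_cast; ring,
      show ((A + d + m : ℕ) : ℤ) - m = A + d by push_cast; ring,
      show ((C + m + 1 : ℕ) : ℤ) - ((m + 1 : ℕ) + d) = C - d by push_cast; ring,
      show ((C + m : ℕ) : ℤ) - (m + d) = C - d by push_cast; ring,
      show ((m + 1 : ℕ) : ℤ) + d = (m + 1 + d : ℕ) by push_cast; ring, zpow_natCast, zpow_natCast]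
    ring

end Vandermonde

/-! ### Alternating bilateral sums -/

section Bilateral

variable {K : Type*} [Field K] {q : K}

theorem sum_Icc_neg_sub (G : ℤ → K) (N : ℕ) :
    ∑ j ∈ Finset.Icc (-N : ℤ) N, (G (j + 1) - G j) = G (N + 1) - G (-N) := by
  induction N with
  | zero => simp
  | succ N ih =>
    have e : Finset.Icc (-(N + 1 : ℕ) : ℤ) (N + 1 : ℕ) =
        insert (-(N + 1 : ℕ) : ℤ) (insert ((N + 1 : ℕ) : ℤ) (Finset.Icc (-N : ℤ) N)) := by
      ext j; simp only [Finset.mem_Icc, Finset.mem_insert]; push_cast; omega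
    rw [e, Finset.sum_insert, Finset.sum_insert, ih]
    · push_cast
      rw [show (-((N : ℤ) + 1) + 1) = -N by ring]; ring
    · simp
    · simp only [Finset.mem_insert, Finset.mem_Icc]; push_cast; omega

theorem sum_Icc_neg_comm (f : ℤ → K) (N : ℕ) :
    ∑ j ∈ Finset.Icc (-N : ℤ) N, f (-j) = ∑ j ∈ Finset.Icc (-N : ℤ) N, f j :=
  Finset.sum_nbij' (fun j => -j) (fun j => -j) (fun j hj => by simp only [Finset.mem_Icc] at hj ⊢; omega)
    (fun j hj => by simp only [Finset.mem_Icc] at hj ⊢; omega) (fun j _ => neg_neg j)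
    (fun j _ => neg_neg j) (fun _ _ => rfl)

/-- Averaging j with -j inserts the very-well-poised factor 1 + q^j, since `triPow q (-j)` is q^j
times `triPow q j`. The weighted summand is the one that telescopes below; the price is a factor 2.
-/
theorem sum_symmetrize (hq : IsGeneric q) {g : ℤ → K} (hg : ∀ j, g (-j) = g j) (N : ℕ) :
    ∑ j ∈ Finset.Icc (-N : ℤ) N, (1 + q ^ j) * ((-1) ^ j * triPow q j * g j) =
      2 * ∑ j ∈ Finset.Icc (-N : ℤ) N, (-1) ^ j * triPow q j * g j := by
  simp only [add_mul, one_mul, Finset.sum_add_distrib, two_mul]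
  congr 1
  rw [← sum_Icc_neg_comm]
  refine Finset.sum_congr rfl fun j _ => ?_
  have e : q ^ (-j) * q ^ j = 1 := by
    rw [← zpow_add₀ hq.ne_zero, neg_add_cancel, zpow_zero]
  have e' : (-1 : K) ^ (-j) = (-1) ^ j := by rw [zpow_neg, ← inv_zpow, inv_neg_one]
  rw [hg, triPow_neg hq, e']
  linear_combination ((-1) ^ j * triPow q j * g j) * e

theorem sum_alternating_fBinom (hq : IsGeneric q) {L N : ℕ} (hL : L ≠ 0) (hN : L ≤ N) :
    ∑ j ∈ Finset.Icc (-N : ℤ) N, (-1) ^ j * triPow q j * fBinom q (2 * L) (L - j) = 0 := by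
  have h0 := hq.ne_zero
  have h := hq.pow_succ_ne_one
  have hg : ∀ j : ℤ, fBinom q (2 * L) (L - -j) = fBinom q (2 * L) (L - j) := fun j => by
    rw [fBinom_two_mul, fBinom_two_mul, sub_neg_eq_add, ← sub_eq_add_neg]; ring
  have key := sum_Icc_neg_sub (fun j : ℤ =>
    -((1 - q ^ (L + j : ℤ)) * ((-1) ^ j * triPow q j * fBinom q (2 * L) (L - j)))) N
  have wz : ∀ j : ℤ, (1 - q ^ L) * ((1 + q ^ j) * ((-1) ^ j * triPow q j * fBinom q (2 * L) (L - j))) =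
      -((1 - q ^ (L + (j + 1) : ℤ)) *
        ((-1) ^ (j + 1) * triPow q (j + 1) * fBinom q (2 * L) (L - (j + 1)))) -
      -((1 - q ^ (L + j : ℤ)) * ((-1) ^ j * triPow q j * fBinom q (2 * L) (L - j))) := by
    intro j
    have e := invPoch_pred h (m := L + j) (n := L + (j + 1)) (by ring)
    rw [fBinom_two_mul, fBinom_two_mul, triPow_succ hq (m := j) rfl,
      invPoch_pred h (m := L - (j + 1)) (n := L - j) (by ring), zpow_add₀ (show (-1 : K) ≠ 0 by norm_num), e]
    generalize invPoch q (L + (j + 1)) = a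
    simp only [zpow_add₀ h0, zpow_sub₀ h0, zpow_natCast, zpow_one]
    have hw : q ^ j ≠ 0 := zpow_ne_zero _ h0
    field_simp
    ring
  rw [Finset.sum_congr rfl fun j _ => (wz j).symm, ← Finset.mul_sum, sum_symmetrize hq hg] at key
  have z1 : fBinom q (2 * L) (L - (N + 1)) = 0 := fBinom_of_neg q _ (by omega)
  -- Lower boundary term: for N = L the first factor vanishes, for N > L the q-binomial does.
  have z2 : (1 - q ^ (L + -N : ℤ)) * fBinom q (2 * L) (L - -N) = 0 := by
    rcases hN.eq_or_lt with rfl | hN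
    · simp
    · rw [fBinom_of_lt q _ (by push_cast; omega), mul_zero]
  have e : (1 - q ^ L) ≠ 0 := by
    obtain ⟨L, rfl⟩ := Nat.exists_eq_succ_of_ne_zero hL
    exact one_sub_pow_succ_ne_zero hq L
  refine (mul_eq_zero_iff_left (mul_ne_zero e hq.two_ne_zero)).mp ?_
  rw [mul_assoc, key, z1]
  linear_combination ((-1) ^ (-N : ℤ) * triPow q (-N)) * z2

/-- The terminating very-well-poised sum behind the first case of the Burge tree. -/
theorem sum_alternating_mul_fBinom (hq : IsGeneric q) (L M : ℕ) {N : ℕ} (hN : L ≤ N) :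
    ∑ j ∈ Finset.Icc (-N : ℤ) N, (-1) ^ j * triPow q j *
        (fBinom q (L + M) (L + j) * fBinom q (L + M) (L - j)) =
      q ^ (L * M) * fBinom q (L + M) L := by
  have h0 := hq.ne_zero
  have h := hq.pow_succ_ne_one
  let g : ℕ → ℤ → K := fun M j =>
    invPoch q (L + j) * invPoch q (L - j) * (invPoch q (M + j) * invPoch q (M - j))
  have hg : ∀ M j, g M (-j) = g M j := fun M j => by
    simp only [g, sub_neg_eq_add, ← sub_eq_add_neg]; ring
  suffices H : ∀ M : ℕ, ∑ j ∈ Finset.Icc (-N : ℤ) N, (-1) ^ j * triPow q j * g M j =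
      q ^ (L * M) * invPoch q L * invPoch q M * invPoch q (L + M : ℕ) by
    have e := qPoch_ne_zero h (L + M)
    have e' : qPoch q (L + M) ^ 2 * (q ^ (L * M) * invPoch q L * invPoch q M * invPoch q (L + M : ℕ)) =
      q ^ (L * M) * fBinom q (L + M) L := by
      rw [fBinom, invPoch_natCast q (L + M), show ((L + M : ℕ) : ℤ) - L = M by push_cast; ring]
      field_simp
    rw [← e', ← H, Finset.mul_sum]
    refine Finset.sum_congr rfl fun j _ => ?_
    simp only [fBinom, g]
    rw [show ((L + M : ℕ) : ℤ) - (L + j) = M - j by push_cast; ring,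
      show ((L + M : ℕ) : ℤ) - (L - j) = M + j by push_cast; ring]
    ring
  intro M
  refine mul_left_cancel₀ hq.two_ne_zero ?_
  rw [← sum_symmetrize hq (hg M)]
  induction M with
  | zero =>
    rw [Finset.sum_eq_single 0]
    · simp [g, invPoch_zero, triPow, zprod_zero, one_add_one_eq_two]
    · intro j _ hj
      have := invPoch_sub_mul_invPoch_add q (r := 0) (j := j) (by omega)
      simp only [g]
      rw [mul_comm (invPoch q ((0 : ℕ) + j)), this]; ring
    · simp
  | succ M ih =>
    -- Telescoping in j gives (1 - q^(M+1)) (1 - q^(L+M+1)) S(M+1) = q^L S(M) for the symmetrized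
    -- sums.
    have key := sum_Icc_neg_sub (fun j : ℤ =>
      -((1 - q ^ (L + j : ℤ)) * (1 - q ^ (M + 1 + j : ℤ)) * ((-1) ^ j * triPow q j * g (M + 1) j))) N
    have wz : ∀ j : ℤ, (1 - q ^ (M + 1)) * (1 - q ^ (L + M + 1)) *
        ((1 + q ^ j) * ((-1) ^ j * triPow q j * g (M + 1) j)) -
        q ^ L * ((1 + q ^ j) * ((-1) ^ j * triPow q j * g M j)) =
      -((1 - q ^ (L + (j + 1) : ℤ)) * (1 - q ^ (M + 1 + (j + 1) : ℤ)) *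
        ((-1) ^ (j + 1) * triPow q (j + 1) * g (M + 1) (j + 1))) -
      -((1 - q ^ (L + j : ℤ)) * (1 - q ^ (M + 1 + j : ℤ)) *
        ((-1) ^ j * triPow q j * g (M + 1) j)) := by
      intro j
      simp only [g]
      rw [show ((M + 1 : ℕ) : ℤ) = M + 1 by push_cast; ring, triPow_succ hq (m := j) rfl,
        show (M : ℤ) + 1 - (j + 1) = M - j by ring,
        zpow_add₀ (show (-1 : K) ≠ 0 by norm_num),
        invPoch_pred h (m := L - (j + 1)) (n := L - j) (by ring),
        invPoch_pred h (m := M - j) (n := M + 1 - j) (by ring),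
        invPoch_pred h (m := M + j) (n := M + 1 + j) (by ring),
        invPoch_pred h (m := M + 1 + j) (n := M + 1 + (j + 1)) (by ring),
        invPoch_pred h (m := L + j) (n := L + (j + 1)) (by ring)]
      generalize invPoch q (L + (j + 1)) = a1
      generalize invPoch q (M + 1 + (j + 1)) = a2
      generalize invPoch q (L - j) = a3
      generalize invPoch q (M + 1 - j) = a4
      generalize triPow q j = T
      generalize (-1 : K) ^ j = s
      simp only [zpow_add₀ h0, zpow_sub₀ h0, zpow_natCast, zpow_one, pow_succ, pow_add]
      have hw : q ^ j ≠ 0 := zpow_ne_zero _ h0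
      generalize q ^ j = y at hw ⊢
      generalize q ^ L = x
      generalize q ^ M = u
      field_simp
      ring
    rw [Finset.sum_congr rfl fun j _ => (wz j).symm, Finset.sum_sub_distrib, ← Finset.mul_sum,
      ← Finset.mul_sum, ih] at key
    have z1 : g (M + 1) (N + 1) = 0 := by
      simp only [g]; rw [invPoch_of_neg q (n := L - (N + 1)) (by omega)]; ring
    have z2 : (1 - q ^ (L + -N : ℤ)) * g (M + 1) (-N) = 0 := by
      simp only [g]
      rcases hN.eq_or_lt with rfl | hN
      · simp
      · rw [invPoch_of_neg q (n := L + -N) (by omega)]; ring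
    have e := mul_ne_zero (one_sub_pow_succ_ne_zero hq M) (one_sub_pow_succ_ne_zero hq (L + M))
    refine mul_left_cancel₀ e ?_
    have e1 := invPoch_pred h (m := M) (n := (M + 1 : ℕ)) (by push_cast; ring)
    have e2 := invPoch_pred h (m := (L + M : ℕ)) (n := (L + M + 1 : ℕ)) (by push_cast; ring)
    rw [zpow_natCast] at e1 e2
    rw [e1, e2, z1] at key
    rw [show L * (M + 1) = L * M + L by ring, pow_add, show L + (M + 1) = L + M + 1 by ring]
    linear_combination key + ((1 - q ^ (M + 1 + -N : ℤ)) * ((-1) ^ (-N : ℤ) * triPow q (-N))) * z2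

end Bilateral

/-! ### The base-preserving transformation -/

section RogersSzego

variable {K : Type*} [Field K] {q : K}

/-- Shifting the index by k loses nothing: f vanishes below 0 and on the last k places before M. -/
theorem sum_range_sub_natCast {M : ℕ} (f : ℤ → K) (hneg : ∀ n < 0, f n = 0) (k : ℕ)
    (hbig : ∀ n : ℤ, M ≤ n + k → f n = 0) :
    ∑ s ∈ Finset.range M, f (s - k) = ∑ a ∈ Finset.range M, f a := by
  rcases le_total k M with h | h
  · obtain ⟨m, rfl⟩ := Nat.exists_eq_add_of_le h
    rw [Finset.sum_range_add, Finset.sum_eq_zero fun s hs => hneg _ (by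
      rw [Finset.mem_range] at hs; omega), zero_add, add_comm k m, Finset.sum_range_add,
      Finset.sum_eq_zero (s := Finset.range k) fun s _ => hbig _ (by push_cast; omega), add_zero]
    refine Finset.sum_congr rfl fun s _ => ?_
    push_cast
    rw [add_sub_cancel_left]
  · rw [Finset.sum_eq_zero fun s hs => hneg _ (by rw [Finset.mem_range] at hs; omega),
      Finset.sum_eq_zero fun s hs => hbig _ (by omega)]

theorem sum_vandermonde_of_lt (hq : IsGeneric q) (A C d : ℕ) {N : ℕ} (hN : C < N) :
    ∑ t ∈ Finset.range N, q ^ (t * (t + d)) * fBinom q A t * fBinom q C (t + d) =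
      fBinom q (A + C) (A + d) := by
  obtain ⟨m, rfl⟩ := Nat.exists_eq_add_of_le (Nat.succ_le_of_lt hN)
  rw [Finset.sum_range_add, sum_vandermonde hq, Finset.sum_eq_zero fun t _ => by
    rw [fBinom_of_lt q C (by push_cast; omega), mul_zero], add_zero]

/-- The `q`-Vandermonde sum with an integer parameter. -/
theorem sum_vandermonde_int (hq : IsGeneric q) (A C : ℕ) (e : ℤ) {N : ℕ} (hA : A < N) (hC : C < N) :
    ∑ t ∈ Finset.range N, q ^ (t * (t + e) : ℤ) * (fBinom q A t * fBinom q C (t + e)) =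
      fBinom q (A + C) (A + e) := by
  rcases le_total 0 e with he | he
  · obtain ⟨d, rfl⟩ := Int.eq_ofNat_of_zero_le he
    rw [← sum_vandermonde_of_lt hq A C d hC]
    refine Finset.sum_congr rfl fun t _ => ?_
    rw [← mul_assoc, ← zpow_natCast]; push_cast; rfl
  · obtain ⟨d, hd⟩ := Int.eq_ofNat_of_zero_le (neg_nonneg.mpr he)
    obtain rfl : e = -d := by omega
    have := sum_range_sub_natCast (M := N)
      (fun n => q ^ ((n + d) * n : ℤ) * (fBinom q A (n + d) * fBinom q C n))
      (fun n hn => by rw [fBinom_of_neg q C hn]; ring) d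
      (fun n hn => by rw [fBinom_of_lt q A (by omega)]; ring)
    simp only [sub_add_cancel] at this
    rw [show (A : ℤ) + -d = (A + C : ℕ) - (C + d) by push_cast; ring, fBinom_symm, add_comm A C,
      ← sum_vandermonde_of_lt hq C A d hA]
    refine Eq.trans this (Finset.sum_congr rfl fun t _ => ?_)
    rw [← zpow_natCast]; push_cast; ring_nf

/-- Both sides are a q-multinomial coefficient. For n > L the truncated `L - n` is irrelevant, since
both sides vanish. -/
theorem fBinom_mul_fBinom_mul (hq : IsGeneric q) (L n : ℕ) (k m : ℤ) :
    fBinom q L n * fBinom q (L - n) k * fBinom q n m =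
      qPoch q L * (invPoch q m * invPoch q (n - m)) * (invPoch q k * invPoch q (L - n - k)) := by
  rcases lt_or_ge L n with h | h
  · rw [fBinom_of_lt q L (by omega), invPoch_mul_invPoch_of_neg q (m := k) (by omega)]; ring
  · have e1 := qPoch_ne_zero hq.pow_succ_ne_one n
    have e2 := qPoch_ne_zero hq.pow_succ_ne_one (L - n)
    simp only [fBinom]
    rw [Nat.cast_sub h, invPoch_natCast, show (L : ℤ) - n = (L - n : ℕ) by omega,
      invPoch_natCast q (L - n)]
    field_simp

/-- The transformation with Rogers–Szegő kernel. -/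
theorem sum_rogersSzego (hq : IsGeneric q) (L j : ℕ) :
    ∑ r ∈ Finset.range (L + 1), ∑ k ∈ Finset.range (L + 1), q ^ (r ^ 2 + L * k) *
        (fBinom q L (2 * r : ℕ) * fBinom q (L - 2 * r) k * fBinom q (2 * r) (r - j)) =
      q ^ (j ^ 2) * fBinom q (2 * L) (L - 2 * j) := by
  have h0 := hq.ne_zero
  -- Here a = r - j, with q^(j²) taken out. Regrouping by s = a + k turns the k-sum into a
  -- q-Vandermonde sum with value [L, s + 2j], and the s-sum into another with value [2L, L + 2j].
  -- The shift L - 2s - 2j in the inner sum can be negative, hence `sum_vandermonde_int`.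
  let T : ℤ → ℤ → K := fun a k => q ^ ((a + k) * (a + k + 2 * j) + k * (L - 2 * a - 2 * j - k)) *
    (qPoch q L * (invPoch q a * invPoch q (a + 2 * j)) *
      (invPoch q k * invPoch q (L - 2 * a - 2 * j - k)))
  have hneg : ∀ k a, a < 0 → T a k = 0 := fun k a ha => by
    simp only [T]; rw [invPoch_of_neg q ha]; ring
  have h1 : ∀ r k : ℕ, q ^ (r ^ 2 + L * k) *
      (fBinom q L (2 * r : ℕ) * fBinom q (L - 2 * r) k * fBinom q (2 * r) (r - j)) =
      q ^ (j ^ 2) * T (r - j) k := by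
    intro r k
    simp only [T]
    rw [fBinom_mul_fBinom_mul hq, ← mul_assoc (q ^ (j ^ 2)), ← zpow_natCast q (j ^ 2),
      ← zpow_add₀ h0, ← zpow_natCast]
    push_cast
    ring_nf
  have h2 : ∀ s k : ℕ, s ∈ Finset.range (L + 1) → T (s - k) k = q ^ (s * (s + 2 * j)) * fBinom q L s *
      (q ^ (k * (k + (L - 2 * s - 2 * j)) : ℤ) * (fBinom q s k * fBinom q (L - s) (k + (L - 2 * s - 2 * j)))) := by
    intro s k hs
    have hs : s ≤ L := by rw [Finset.mem_range] at hs; omega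
    have := fBinom_mul_fBinom_mul hq L s (k + (L - 2 * s - 2 * j)) k
    have e : q ^ ((s - k + k) * (s - k + k + 2 * j) + k * (L - 2 * (s - k) - 2 * j - k) : ℤ) =
        q ^ (s * (s + 2 * j)) * q ^ (k * (k + (L - 2 * s - 2 * j)) : ℤ) := by
      rw [← zpow_natCast, ← zpow_add₀ h0]; congr 1; push_cast; ring
    simp only [T]
    rw [e, show (L : ℤ) - 2 * (s - k) - 2 * j - k = k + (L - 2 * s - 2 * j) by ring,
      show (s : ℤ) - k + 2 * j = L - s - (k + (L - 2 * s - 2 * j)) by ring]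
    linear_combination (-q ^ (s * (s + 2 * j)) * q ^ (k * (k + (L - 2 * s - 2 * j)) : ℤ)) * this
  simp only [h1, ← Finset.mul_sum]
  congr 1
  rw [Finset.sum_comm]
  have h3 : ∀ k : ℕ, ∑ r ∈ Finset.range (L + 1), T (r - j) k =
      ∑ s ∈ Finset.range (L + 1), T (s - k) k := by
    intro k
    rw [sum_range_sub_natCast (fun a => T a k) (hneg k) j, sum_range_sub_natCast (fun a => T a k)
      (hneg k) k]
    all_goals
      intro n hn
      rcases lt_or_ge n 0 with hn0 | hn0
      · exact hneg k n hn0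
      · simp only [T]; rw [invPoch_of_neg q (n := L - 2 * n - 2 * j - k) (by omega)]; ring
  rw [Finset.sum_congr rfl fun k _ => h3 k, Finset.sum_comm]
  have h4 : ∀ s ∈ Finset.range (L + 1), ∑ k ∈ Finset.range (L + 1), T (s - k) k =
      q ^ (s * (s + 2 * j)) * fBinom q L s * fBinom q L (s + (2 * j : ℕ)) := by
    intro s hs
    have hs' : s ≤ L := by rw [Finset.mem_range] at hs; omega
    rw [Finset.sum_congr rfl fun k _ => h2 s k hs, ← Finset.mul_sum,
      sum_vandermonde_int hq s (L - s) _ (by omega) (by omega), Nat.add_sub_cancel' hs',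
      ← fBinom_symm q L (s + (2 * j : ℕ))]
    congr 2; push_cast; ring
  rw [Finset.sum_congr rfl h4, sum_vandermonde hq, ← two_mul, ← fBinom_symm]
  congr 1; push_cast; ring

end RogersSzego

/-! ### The five positive kernels over ℤ[X] -/

section Kernel

theorem sum_range_two_mul {R : Type*} [AddCommMonoid R] (f : ℕ → R) (M : ℕ)
    (hf : ∀ r, f (2 * r + 1) = 0) :
    ∑ n ∈ Finset.range (2 * M), f n = ∑ r ∈ Finset.range M, f (2 * r) := by
  induction M with
  | zero => simp
  | succ M ih =>
    rw [show 2 * (M + 1) = 2 * M + 1 + 1 by ring, Finset.sum_range_succ, Finset.sum_range_succ, ih,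
      hf, add_zero, Finset.sum_range_succ]

/-- At even s = 2j only even n = 2r have the right parity, so Hermite coefficients become
central-type q-binomials [2r, r - j]. -/
theorem sum_mul_hermiteCoeff_two_mul {K : Type*} [Field K] (Q : K) (C : ℕ → K) (M : ℕ) (j : ℤ) :
    ∑ n ∈ Finset.range (2 * M), C n * hermiteCoeff Q n (2 * j) =
      ∑ r ∈ Finset.range M, C (2 * r) * fBinom Q (2 * r) (r - j) := by
  rw [sum_range_two_mul]
  · refine Finset.sum_congr rfl fun r _ => ?_
    rw [hermiteCoeff_eq Q (k := r - j) (by push_cast; ring)]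
  · intro r
    rw [hermiteCoeff_of_not_dvd Q (by push_cast; omega), mul_zero]

/-- The field of fractions of `ℤ[X]`, with no structure but that of a field. -/
def FracField : Type := FractionRing ℤ[X]

noncomputable instance : Field FracField := inferInstanceAs (Field (FractionRing ℤ[X]))

/-- The embedding of `ℤ[X]` into its field of fractions. -/
noncomputable def toFracField : ℤ[X] →+* FracField := algebraMap ℤ[X] (FractionRing ℤ[X])

/-- The variable, as an element of the field of fractions of `ℤ[X]`. -/
noncomputable def fracX : FracField := toFracField X

theorem aeval_fracX (P : ℤ[X]) : aeval fracX P = toFracField P := by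
  have : (aeval fracX : ℤ[X] →ₐ[ℤ] FracField).toRingHom = toFracField :=
    Polynomial.ringHom_ext (fun a => by simp) (by simp [fracX])
  exact congrArg (fun f : ℤ[X] →+* FracField => f P) this

theorem aeval_fracX_injective :
    Function.Injective (aeval fracX : ℤ[X] →ₐ[ℤ] FracField) := fun P R h => by
  rw [aeval_fracX, aeval_fracX] at h
  exact IsFractionRing.injective ℤ[X] (FractionRing ℤ[X]) h

theorem aeval_fracX_pow (p : ℕ) (P : ℤ[X]) : aeval (fracX ^ p) P = aeval fracX (expand ℤ p P) :=
  (expand_aeval p P fracX).symm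

theorem aeval_fracX_pow_injective {p : ℕ} (hp : 0 < p) :
    Function.Injective (aeval (fracX ^ p) : ℤ[X] →ₐ[ℤ] FracField) := fun P R h => by
  rw [aeval_fracX_pow, aeval_fracX_pow] at h
  exact expand_injective hp (aeval_fracX_injective h)

theorem isGeneric_fracX : IsGeneric fracX := by
  have hn : ∀ n : ℕ, n ≠ 0 → fracX ^ n ≠ 1 := by
    intro n hn h
    have : (X ^ n : ℤ[X]) = 1 := aeval_fracX_injective (by simpa using h)
    have := congrArg natDegree this
    rw [natDegree_X_pow, natDegree_one] at this
    exact hn this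
  refine ⟨fun h => X_ne_zero (R := ℤ) (aeval_fracX_injective (by simpa using h)), fun n h0 h => ?_,
    fun h => two_ne_zero (α := ℤ[X]) (aeval_fracX_injective (by rwa [map_ofNat, map_zero]))⟩
  rcases n with n | n
  · exact hn n (by rintro rfl; exact h0 rfl) (by simpa using h)
  · rw [zpow_negSucc, inv_eq_one] at h
    exact hn _ (Nat.succ_ne_zero n) h

/-- All coefficients of `P` are nonnegative. -/
def HasNonnegCoeff (P : ℤ[X]) : Prop := ∀ n, 0 ≤ P.coeff n

namespace HasNonnegCoeff

theorem zero : HasNonnegCoeff 0 := fun n => by simp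

theorem X_pow (n : ℕ) : HasNonnegCoeff (X ^ n) := fun m => by
  rw [coeff_X_pow]; split_ifs <;> norm_num

theorem one : HasNonnegCoeff 1 := by simpa using X_pow 0

theorem add {P R : ℤ[X]} (hP : HasNonnegCoeff P) (hR : HasNonnegCoeff R) :
    HasNonnegCoeff (P + R) := fun n => by
  rw [coeff_add]; exact add_nonneg (hP n) (hR n)

theorem mul {P R : ℤ[X]} (hP : HasNonnegCoeff P) (hR : HasNonnegCoeff R) :
    HasNonnegCoeff (P * R) := fun n => by
  rw [coeff_mul]; exact Finset.sum_nonneg fun x _ => mul_nonneg (hP _) (hR _)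

theorem sum {ι : Type*} {s : Finset ι} {f : ι → ℤ[X]} (h : ∀ i ∈ s, HasNonnegCoeff (f i)) :
    HasNonnegCoeff (∑ i ∈ s, f i) := fun n => by
  rw [finsetSum_coeff]; exact Finset.sum_nonneg fun i hi => h i hi n

theorem prod {ι : Type*} {s : Finset ι} {f : ι → ℤ[X]} (h : ∀ i ∈ s, HasNonnegCoeff (f i)) :
    HasNonnegCoeff (∏ i ∈ s, f i) :=
  Finset.prod_induction _ _ (fun _ _ => mul) one h

theorem expand {P : ℤ[X]} (hP : HasNonnegCoeff P) {p : ℕ} (hp : 0 < p) :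
    HasNonnegCoeff (Polynomial.expand ℤ p P) := fun n => by
  rw [coeff_expand hp]; split_ifs
  · exact hP _
  · exact le_rfl

theorem one_add_X_pow (n : ℕ) : HasNonnegCoeff (1 + X ^ n) := one.add (X_pow n)

theorem gauss : ∀ n k : ℕ, HasNonnegCoeff (gauss n k)
  | _, 0 => by rw [BorweinBressoud.gauss]; exact one
  | 0, _ + 1 => by rw [BorweinBressoud.gauss]; exact zero
  | n + 1, k + 1 => by
    rw [BorweinBressoud.gauss]
    exact (gauss n k).add ((X_pow _).mul (gauss n (k + 1)))

end HasNonnegCoeff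

/-- `κ` is the kernel of a positivity-preserving transformation
`∑_r κ(L, r; q) [2r, r - j]_{q^p} = q^(c j²) [2L, L - 2j]_q`. -/
structure IsPositiveKernel (p c : ℕ) (κ : ℕ → ℕ → ℤ[X]) : Prop where
  nonneg : ∀ L r, HasNonnegCoeff (κ L r)
  sum_eq : ∀ (L : ℕ) (j : ℤ), ∑ r ∈ Finset.range (L + 1),
    κ L r * expand ℤ p (qBinom (2 * r : ℕ) (r - j)) =
      X ^ (c * j.natAbs ^ 2) * qBinom (2 * L : ℕ) (L - 2 * j)

theorem negPoch_div {K : Type*} [Field K] {q : K} (hq : IsGeneric q) (n m : ℕ) :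
    negPoch q (n + m : ℕ) / negPoch q n = ∏ i ∈ Finset.range m, (1 + q ^ (n + 1 + i)) := by
  rw [div_eq_iff (negPoch_ne_zero hq n)]
  induction m with
  | zero => simp
  | succ m ih =>
    rw [Finset.prod_range_succ, mul_right_comm, ← ih,
      negPoch_succ hq (m := (n + m : ℕ)) (n := (n + (m + 1) : ℕ)) (by push_cast; ring),
      zpow_natCast, mul_comm, show n + (m + 1) = n + 1 + m by ring]

/-- The kernel of the quadratic transformation without Gaussian factor. -/
noncomputable def quadraticKernel (L r : ℕ) : ℤ[X] :=
  X ^ ((L - 2 * r) * (L - 2 * r - 1) / 2) *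
    (∏ i ∈ Finset.range (L - 2 * r), (1 + X ^ (2 * r + 1 + i))) * gauss L (2 * r)

theorem isPositiveKernel_quadratic : IsPositiveKernel 2 0 quadraticKernel where
  nonneg L r := ((HasNonnegCoeff.X_pow _).mul
    (HasNonnegCoeff.prod fun _ _ => HasNonnegCoeff.one_add_X_pow _)).mul (HasNonnegCoeff.gauss _ _)
  sum_eq L j := by
    have hq := isGeneric_fracX
    apply aeval_fracX_injective
    have key := sum_quadratic hq (L := L) (N := 2 * (L + 1)) (by omega) (2 * j)
    rw [sum_mul_hermiteCoeff_two_mul (fracX ^ 2) (fun n : ℕ => triPow fracX (L - n) *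
      (negPoch fracX L / negPoch fracX n) * fBinom fracX L n)] at key
    simp only [zero_mul, pow_zero, one_mul, map_sum, map_mul, ← aeval_fracX_pow,
      aeval_qBinom hq.pow_succ_ne_one, aeval_qBinom (hq.pow two_ne_zero).pow_succ_ne_one]
    rw [← key]
    refine Finset.sum_congr rfl fun r _ => ?_
    congr 1
    -- For 2r > L the truncated `L - 2 * r` in the kernel means nothing, but `gauss L (2 * r)` is
    -- zero.
    rcases lt_or_ge L (2 * r) with h | h
    · rw [quadraticKernel, gauss_eq_zero _ _ h, fBinom_of_lt _ _ (by omega)]; simp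
    · obtain ⟨m, rfl⟩ := Nat.exists_eq_add_of_le h
      rw [quadraticKernel, Nat.add_sub_cancel_left, negPoch_div hq,
        show ((2 * r + m : ℕ) : ℤ) - (2 * r : ℕ) = m by push_cast; ring, triPow_natCast hq]
      simp [aeval_gauss hq.pow_succ_ne_one, map_prod]

/-- The kernel of the quadratic transformation with Gaussian factor `q ^ (2 j²)`. -/
noncomputable def quadraticDualKernel (L r : ℕ) : ℤ[X] :=
  X ^ (2 * r ^ 2) *
    (∏ i ∈ Finset.range (L - 2 * r), (1 + X ^ (2 * r + 1 + i))) * gauss L (2 * r)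

theorem isPositiveKernel_quadraticDual : IsPositiveKernel 2 2 quadraticDualKernel where
  nonneg L r := ((HasNonnegCoeff.X_pow _).mul
    (HasNonnegCoeff.prod fun _ _ => HasNonnegCoeff.one_add_X_pow _)).mul (HasNonnegCoeff.gauss _ _)
  sum_eq L j := by
    have hq := isGeneric_fracX
    have hq2 := hq.pow (p := 2) two_ne_zero
    have hq4 := hq.pow (p := 4) four_ne_zero
    -- The polynomial variable is matched with q², because `sum_quadratic_dual` is an identity in
    -- bases q² and q⁴.
    apply aeval_fracX_pow_injective two_pos
    have key := sum_quadratic_dual hq (L := L) (N := 2 * (L + 1)) (by omega) (2 * j)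
    rw [sum_mul_hermiteCoeff_two_mul (fracX ^ 4) (fun n : ℕ => sqPow fracX n *
      (negPoch (fracX ^ 2) L / negPoch (fracX ^ 2) n) * fBinom (fracX ^ 2) L n)] at key
    have e : ∀ P : ℤ[X], aeval (fracX ^ 2) (expand ℤ 2 P) = aeval (fracX ^ 4) P := fun P => by
      rw [expand_aeval, ← pow_mul]
    have e2 : sqPow fracX (2 * j) = (fracX ^ 2) ^ (2 * j.natAbs ^ 2) := by
      rw [sqPow_eq hq, ← pow_mul, ← zpow_natCast]
      congr 1; push_cast; rw [sq_abs]; ring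
    simp only [map_sum, map_mul, e, aeval_qBinom hq4.pow_succ_ne_one,
      aeval_qBinom hq2.pow_succ_ne_one, map_pow, aeval_X]
    rw [← e2, ← key]
    refine Finset.sum_congr rfl fun r _ => ?_
    congr 1
    rcases lt_or_ge L (2 * r) with h | h
    · rw [quadraticDualKernel, gauss_eq_zero _ _ h, fBinom_of_lt _ _ (by omega)]; simp
    · obtain ⟨m, rfl⟩ := Nat.exists_eq_add_of_le h
      have e3 : sqPow fracX (2 * r : ℕ) = (fracX ^ 2) ^ (2 * r ^ 2) := by
        rw [sqPow_eq hq, ← pow_mul, ← zpow_natCast]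
        congr 1; push_cast; ring
      rw [quadraticDualKernel, Nat.add_sub_cancel_left, negPoch_div hq2, e3]
      simp [aeval_gauss hq2.pow_succ_ne_one, map_prod]

/-- The polynomial `q ^ m * (-1/q;q²)_m`. -/
noncomputable def quarticFactor : ℕ → ℤ[X]
  | 0 => 1
  | m + 1 => X ^ m * (1 + X) * ∏ i ∈ Finset.range m, (1 + X ^ (2 * i + 1))

/-- The first factor of `quarticCoeff` is q (1 + 1/q) = 1 + q, so no negative power survives and the
kernel is a genuine polynomial. -/
theorem aeval_quarticFactor {K : Type*} [Field K] {q : K} (hq : IsGeneric q) :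
    ∀ m : ℕ, aeval q (quarticFactor m) = quarticCoeff q m
  | 0 => by simp [quarticFactor, quarticCoeff, zprod_zero]
  | 1 => by
    have h0 := hq.ne_zero
    rw [quarticCoeff_succ hq (m := 0) (n := (1 : ℕ)) (by simp)]
    simp [quarticFactor, quarticCoeff, zprod_zero, zpow_neg]
    field_simp
    ring
  | m + 2 => by
    rw [quarticCoeff_succ hq (m := (m + 1 : ℕ)) (n := (m + 2 : ℕ)) (by push_cast; ring),
      ← aeval_quarticFactor hq (m + 1),
      show 2 * ((m + 2 : ℕ) : ℤ) - 3 = (2 * m + 1 : ℕ) by push_cast; ring, zpow_natCast,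
      quarticFactor, quarticFactor, Finset.prod_range_succ]
    simp only [map_mul, map_pow, map_add, map_one, aeval_X]
    ring

/-- The kernel of the quartic transformation. -/
noncomputable def quarticKernel (L r : ℕ) : ℤ[X] :=
  quarticFactor (L - 2 * r) * expand ℤ 2 (gauss L (2 * r))

theorem isPositiveKernel_quartic : IsPositiveKernel 4 0 quarticKernel where
  nonneg L r := by
    refine HasNonnegCoeff.mul ?_ ((HasNonnegCoeff.gauss _ _).expand two_pos)
    rcases L - 2 * r with _ | m
    · exact HasNonnegCoeff.one
    · have := HasNonnegCoeff.one_add_X_pow 1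
      rw [pow_one] at this
      exact ((HasNonnegCoeff.X_pow _).mul this).mul
        (HasNonnegCoeff.prod fun _ _ => HasNonnegCoeff.one_add_X_pow _)
  sum_eq L j := by
    have hq := isGeneric_fracX
    have hq2 := hq.pow (p := 2) two_ne_zero
    have hq4 := hq.pow (p := 4) four_ne_zero
    apply aeval_fracX_injective
    have key := sum_quartic hq (L := L) (N := 2 * (L + 1)) (by omega) (2 * j)
    rw [sum_mul_hermiteCoeff_two_mul (fracX ^ 4) (fun n : ℕ => quarticCoeff fracX (L - n) *
      fBinom (fracX ^ 2) L n)] at key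
    simp only [zero_mul, pow_zero, one_mul, map_sum, map_mul, ← aeval_fracX_pow,
      aeval_qBinom hq.pow_succ_ne_one, aeval_qBinom hq4.pow_succ_ne_one]
    rw [← key]
    refine Finset.sum_congr rfl fun r _ => ?_
    congr 1
    rw [quarticKernel, map_mul, ← aeval_fracX_pow, aeval_gauss hq2.pow_succ_ne_one]
    rcases lt_or_ge L (2 * r) with h | h
    · rw [fBinom_of_lt _ _ (by omega), mul_zero, mul_zero]
    · rw [aeval_quarticFactor hq, Nat.cast_sub h]

/-- The kernel of the self-dual quadratic transformation. -/
noncomputable def selfDualKernel (L r : ℕ) : ℤ[X] :=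
  X ^ (r ^ 2) * (if L = 2 * r then 1 else
    (1 + X ^ L) * ∏ i ∈ Finset.range (L - 2 * r - 1), (1 + X ^ (2 * (r + 1 + i)))) * gauss L (2 * r)

theorem isPositiveKernel_selfDual : IsPositiveKernel 2 1 selfDualKernel where
  nonneg L r := by
    refine ((HasNonnegCoeff.X_pow _).mul ?_).mul (HasNonnegCoeff.gauss _ _)
    split_ifs
    · exact HasNonnegCoeff.one
    · exact (HasNonnegCoeff.one_add_X_pow _).mul
        (HasNonnegCoeff.prod fun _ _ => HasNonnegCoeff.one_add_X_pow _)
  sum_eq L j := by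
    have hq := isGeneric_fracX
    have hq2 := hq.pow (p := 2) two_ne_zero
    apply aeval_fracX_injective
    have key := sum_selfDualTerm hq j L (N := L + 1) (by omega)
    have e2 : sqPow fracX j = fracX ^ (1 * j.natAbs ^ 2) := by
      rw [sqPow_eq hq, ← zpow_natCast]
      congr 1; push_cast; rw [sq_abs]; ring
    simp only [map_sum, map_mul, ← aeval_fracX_pow, aeval_qBinom hq.pow_succ_ne_one,
      aeval_qBinom hq2.pow_succ_ne_one, map_pow, aeval_X]
    rw [← e2, ← key]
    refine Finset.sum_congr rfl fun r _ => ?_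
    rw [selfDualTerm]
    congr 1
    rw [selfDualKernel, map_mul, aeval_gauss hq.pow_succ_ne_one]
    push_cast
    rcases lt_or_ge L (2 * r) with h | h
    · rw [fBinom_of_lt _ _ (by omega), mul_zero, mul_zero]
    · congr 1
      have e3 : sqPow fracX r = fracX ^ (r ^ 2) := by
        rw [sqPow_eq hq, ← zpow_natCast]; congr 1; push_cast; ring
      rw [e3, map_mul, map_pow, aeval_X]
      congr 1
      have e5 := negPoch_ne_zero hq2 r
      split_ifs with hL
      · subst hL
        have e4 := negPoch_succ hq2 (m := r - 1) (n := r) (by ring)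
        rw [zpow_natCast] at e4
        rw [show ((2 * r : ℕ) : ℤ) - r - 1 = r - 1 by push_cast; ring, pow_mul, ← e4, div_self e5,
          map_one]
      · obtain ⟨m, rfl⟩ : ∃ m, L = 2 * r + m + 1 := ⟨L - 2 * r - 1, by omega⟩
        rw [show ((2 * r + m + 1 : ℕ) : ℤ) - r - 1 = (r + m : ℕ) by push_cast; ring, mul_div_assoc,
          negPoch_div hq2, show 2 * r + m + 1 - 2 * r - 1 = m by omega]
        simp [map_prod, pow_mul]

/-- The kernel of the transformation that leaves the base unchanged. -/
noncomputable def rogersSzegoKernel (L r : ℕ) : ℤ[X] :=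
  X ^ (r ^ 2) * gauss L (2 * r) *
    ∑ k ∈ Finset.range (L + 1), X ^ (L * k) * gauss (L - 2 * r) k

theorem isPositiveKernel_rogersSzego : IsPositiveKernel 1 1 rogersSzegoKernel where
  nonneg L r := ((HasNonnegCoeff.X_pow _).mul (HasNonnegCoeff.gauss _ _)).mul
    (HasNonnegCoeff.sum fun _ _ => (HasNonnegCoeff.X_pow _).mul (HasNonnegCoeff.gauss _ _))
  sum_eq L j := by
    have hq := isGeneric_fracX
    -- `sum_rogersSzego` is available only for natural j; the symmetry of [2L, L - s] in s covers
    -- negative j.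
    have hs : ∀ (L : ℕ) (s : ℤ), qBinom (2 * L : ℕ) (L - s) = qBinom (2 * L : ℕ) (L - |s|) := by
      intro L s
      rcases abs_choice s with h | h
      · rw [h]
      · apply aeval_fracX_injective
        rw [aeval_qBinom hq.pow_succ_ne_one, aeval_qBinom hq.pow_succ_ne_one, h, fBinom_two_mul,
          fBinom_two_mul, sub_neg_eq_add, ← sub_eq_add_neg, mul_right_comm]
    have e : ∀ r : ℕ, qBinom (2 * r : ℕ) (r - j) = qBinom (2 * r : ℕ) (r - (j.natAbs : ℕ)) :=
      fun r => by rw [hs, Int.abs_eq_natAbs]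
    have e' : qBinom (2 * L : ℕ) (L - 2 * j) = qBinom (2 * L : ℕ) (L - 2 * (j.natAbs : ℕ)) := by
      rw [hs, Int.abs_eq_natAbs, Int.natAbs_mul]; push_cast; rfl
    rw [e']
    simp only [e]
    apply aeval_fracX_injective
    have key := sum_rogersSzego hq L j.natAbs
    simp only [map_sum, map_mul, ← aeval_fracX_pow, pow_one, aeval_qBinom hq.pow_succ_ne_one,
      map_pow, aeval_X, one_mul]
    rw [← key]
    refine Finset.sum_congr rfl fun r _ => ?_
    rw [rogersSzegoKernel]
    simp only [map_sum, map_mul, map_pow, aeval_X, aeval_gauss hq.pow_succ_ne_one, Finset.mul_sum,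
      Finset.sum_mul]
    refine Finset.sum_congr rfl fun k _ => ?_
    rw [pow_add]; ring

end Kernel

/-! ### The Burge transform of products of two q-binomials -/

section Burge

theorem qBinom_eq_zero {n k : ℤ} (h : ¬(0 ≤ k ∧ k ≤ n)) : qBinom n k = 0 := if_neg h

theorem HasNonnegCoeff.qBinom (n k : ℤ) : HasNonnegCoeff (qBinom n k) := by
  unfold BorweinBressoud.qBinom
  split_ifs
  · exact HasNonnegCoeff.gauss _ _
  · exact HasNonnegCoeff.zero

theorem aeval_fracX_qBinom (n : ℕ) (k : ℤ) : aeval fracX (qBinom n k) = fBinom fracX n k :=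
  aeval_qBinom isGeneric_fracX.pow_succ_ne_one n k

theorem qBinom_symm {n k l : ℤ} (h : k + l = n) : qBinom n k = qBinom n l := by
  rcases lt_or_ge n 0 with hn | hn
  · rw [qBinom_eq_zero (by omega), qBinom_eq_zero (by omega)]
  · obtain ⟨n, rfl⟩ := Int.eq_ofNat_of_zero_le hn
    apply aeval_fracX_injective
    rw [aeval_fracX_qBinom, aeval_fracX_qBinom, ← fBinom_symm, show (n : ℤ) - k = l by omega]

/-- The product of two `q`-binomial coefficients on which the Burge transform acts. -/
noncomputable def burgeProd (L M a b : ℤ) : ℤ[X] :=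
  qBinom (L + M + a - b) (L + a) * qBinom (L + M - a + b) (L - a)

theorem burgeProd_neg (L M a b : ℤ) : burgeProd L M (-a) (-b) = burgeProd L M a b := by
  rw [burgeProd, burgeProd, mul_comm]
  congr 2 <;> ring

/-- Each of the two q-binomials is replaced by its complement. -/
theorem burgeProd_swap (L M a b : ℤ) : burgeProd M L b a = burgeProd L M a b := by
  rw [burgeProd, burgeProd, mul_comm]
  congr 1
  · rw [show M + L - b + a = L + M + a - b by ring]
    exact qBinom_symm (by ring)
  · rw [show M + L + b - a = L + M - a + b by ring]
    exact qBinom_symm (by ring)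

theorem sum_range_eq_of_eq_zero {R : Type*} [AddCommMonoid R] {f : ℕ → R} {M N : ℕ}
    (hM : ∀ n, M ≤ n → f n = 0) (hN : ∀ n, N ≤ n → f n = 0) :
    ∑ n ∈ Finset.range M, f n = ∑ n ∈ Finset.range N, f n := by
  rcases le_total M N with h | h
  · exact Finset.sum_subset (Finset.range_mono h) fun n _ hn => hM n (by simpa using hn)
  · exact (Finset.sum_subset (Finset.range_mono h) fun n _ hn => hN n (by simpa using hn)).symm

theorem burgeProd_eq_zero {L M a b : ℤ} (_ : 0 ≤ a) (_ : 0 ≤ b)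
    (h : L + M + a - b < 0 ∨ L + M - a + b < 0) : burgeProd L M a b = 0 := by
  rcases h with h | h
  · rw [burgeProd, qBinom_eq_zero (k := L + a) (by omega), zero_mul]
  · rw [burgeProd, qBinom_eq_zero (k := L - a) (by omega), mul_zero]

/-- Shift of the summation index that brings the Burge transform into hypergeometric form. -/
theorem sum_burge_shift {A C L a b : ℕ} (hA : (A : ℤ) = L + a - b) (hC : (C : ℤ) = L - a + b)
    (w : ℤ → FracField) :
    ∑ i ∈ Finset.range (L + 1), fracX ^ (i ^ 2) * w i *
        aeval fracX (burgeProd (L - i) i a b) =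
      fracX ^ (b ^ 2) * ∑ t ∈ Finset.range (A + 1), fracX ^ (t * (t + 2 * b)) * fBinom fracX A t *
        fBinom fracX C (t + (2 * b : ℕ)) * w (t + b) := by
  have h0 := isGeneric_fracX.ne_zero
  have hz : ∀ n : ℤ, n < 0 ∨ A < n ∨ C < n + 2 * b →
      fBinom fracX A n * fBinom fracX C (n + 2 * b) = 0 := by
    rintro n (h | h | h)
    · rw [fBinom_of_neg _ _ h, zero_mul]
    · rw [fBinom_of_lt _ _ h, zero_mul]
    · rw [fBinom_of_lt _ C h, mul_zero]
  have := sum_range_sub_natCast (M := L + 1) (fun n : ℤ => fracX ^ ((n + b) ^ 2) * w (n + b) *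
    (fBinom fracX A n * fBinom fracX C (n + 2 * b)))
    (fun n hn => by rw [hz n (Or.inl hn), mul_zero]) b
    (fun n hn => by rw [hz n (by push_cast at hn; omega), mul_zero])
  simp only [sub_add_cancel] at this
  have e : ∀ i : ℕ, aeval fracX (burgeProd (L - i) i a b) =
      fBinom fracX A (i - b) * fBinom fracX C (i - b + 2 * b) := by
    intro i
    rw [burgeProd, show (L : ℤ) - i + i + a - b = A by omega,
      show (L : ℤ) - i + i - a + b = C by omega, map_mul, aeval_fracX_qBinom, aeval_fracX_qBinom,
      ← fBinom_symm, ← fBinom_symm _ C, show (A : ℤ) - (L - i + a) = i - b by omega,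
      show (C : ℤ) - (L - i - a) = i - b + 2 * b by omega]
  rw [sum_range_eq_of_eq_zero (M := A + 1) (N := L + 1), Finset.mul_sum]
  · refine Eq.trans (Finset.sum_congr rfl fun i _ => ?_) (this.trans
      (Finset.sum_congr rfl fun t _ => ?_))
    · rw [e, ← zpow_natCast]; push_cast; rfl
    · rw [show fracX ^ (((t : ℤ) + b) ^ 2) = fracX ^ (b ^ 2) * fracX ^ (t * (t + 2 * b)) by
        rw [← pow_add, ← zpow_natCast]; congr 1; push_cast; ring]
      push_cast
      ring
  · intro n hn
    rw [fBinom_of_lt _ A (by omega)]; ring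
  · intro n hn
    have := hz n (by omega)
    rw [mul_assoc (fracX ^ _), Nat.cast_mul, Nat.cast_two, this]; ring

theorem exists_natCast_of_burge {L a b : ℕ} (h : ¬((L : ℤ) + a - b < 0 ∨ (L : ℤ) - a + b < 0)) :
    ∃ A C : ℕ, (A : ℤ) = L + a - b ∧ (C : ℤ) = L - a + b :=
  ⟨(L + a - b : ℤ).toNat, (L - a + b : ℤ).toNat, Int.toNat_of_nonneg (by omega),
    Int.toNat_of_nonneg (by omega)⟩

/-- The M → ∞ analogue of `sum_burgeProd`: the weight depending on M disappears and q-Vandermonde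
replaces q-Pfaff–Saalschütz. -/
theorem sum_burgeProd_limit (L a b : ℕ) :
    ∑ i ∈ Finset.range (L + 1), X ^ (i ^ 2) * burgeProd (L - i) i a b =
      X ^ (b ^ 2) * qBinom (2 * L : ℕ) (L - (a + b)) := by
  by_cases h : (L : ℤ) + a - b < 0 ∨ (L : ℤ) - a + b < 0
  · rw [Finset.sum_eq_zero fun i _ => by
      rw [burgeProd_eq_zero (by omega) (by omega) (by omega), mul_zero],
      qBinom_eq_zero (by omega), mul_zero]
  · obtain ⟨A, C, hA, hC⟩ := exists_natCast_of_burge h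
    apply aeval_fracX_injective
    have key := sum_burge_shift hA hC fun _ => 1
    simp only [mul_one] at key
    simp only [map_sum, map_mul, map_pow, aeval_X, aeval_fracX_qBinom]
    have hN := sum_vandermonde isGeneric_fracX A C (2 * b)
    rw [key, sum_range_eq_of_eq_zero (M := A + 1) (N := C + 1), hN,
      show A + C = 2 * L by omega, ← fBinom_symm]
    · congr 2; push_cast; omega
    · intro n hn
      rw [fBinom_of_lt _ A (by omega)]; ring
    · intro n hn
      rw [fBinom_of_lt _ C (by omega)]; ring

theorem sum_burgeProd (L M a b : ℕ) :
    ∑ i ∈ Finset.range (L + 1), X ^ (i ^ 2) * qBinom (2 * L + M - i) (2 * L) *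
        burgeProd (L - i) i a b =
      X ^ (b ^ 2) * burgeProd L M (a + b) b := by
  by_cases h : (L : ℤ) + a - b < 0 ∨ (L : ℤ) - a + b < 0
  · rw [Finset.sum_eq_zero fun i _ => by
      rw [burgeProd_eq_zero (L := L - i) (by omega) (by omega) (by omega), mul_zero],
      burgeProd, qBinom_eq_zero (k := L - (a + b)) (by omega), mul_zero, mul_zero]
  obtain ⟨A, C, hA, hC⟩ := exists_natCast_of_burge h
  -- The Saalschütz parameter is m = M - b. For M < b both sides vanish: each summand has either i >
  -- M or i < b.
  rcases lt_or_ge M b with hM | hM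
  · rw [Finset.sum_eq_zero fun i _ => by
      rcases lt_or_ge M i with hi | hi
      · rw [qBinom_eq_zero (k := 2 * L) (by omega)]; ring
      · rw [burgeProd, qBinom_eq_zero (k := L - i + a) (by omega)]; ring,
      burgeProd, qBinom_eq_zero (k := L + (a + b)) (by omega)]
    ring
  · obtain ⟨m, rfl⟩ := Nat.exists_eq_add_of_le hM
    apply aeval_fracX_injective
    have key := sum_burge_shift hA hC fun i =>
      aeval fracX (qBinom (2 * L + (b + m : ℕ) - i) (2 * L))
    simp only [map_sum, map_mul, map_pow, aeval_X]
    rw [key, burgeProd]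
    congr 1
    have hS := sum_saalschutz isGeneric_fracX A C (2 * b) m
    rw [show (L : ℤ) + (b + m : ℕ) + (a + b) - b = (A + 2 * b + m : ℕ) by push_cast; omega,
      show (L : ℤ) + (b + m : ℕ) - (a + b) + b = (C + m : ℕ) by push_cast; omega, map_mul,
      aeval_fracX_qBinom, aeval_fracX_qBinom, ← fBinom_symm, ← fBinom_symm _ (C + m),
      show ((A + 2 * b + m : ℕ) : ℤ) - (L + (a + b)) = m by push_cast; omega,
      show ((C + m : ℕ) : ℤ) - (L - (a + b)) = m + (2 * b : ℕ) by push_cast; omega, ← hS]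
    refine Finset.sum_congr rfl fun t ht => ?_
    rw [Finset.mem_range] at ht
    rw [show (2 * L : ℤ) + (b + m : ℕ) - (t + b) = (A + C + m - t : ℕ) by omega, aeval_fracX_qBinom,
      show (2 * L : ℤ) = A + C by omega]

end Burge

/-! ### Positivity along the Burge tree and under doubling of K -/

section Positivity

/-- `c j² - j (j + 1) / 2`, a natural number for `c ≥ 1`. -/
def burgeExp (c : ℕ) (j : ℤ) : ℕ := (c * j ^ 2 - j * (j + 1) / 2).toNat

theorem two_mul_burgeExp {c : ℕ} (hc : 0 < c) (j : ℤ) :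
    2 * (burgeExp c j : ℤ) = 2 * c * j ^ 2 - j * (j + 1) := by
  have h : 2 * (j * (j + 1) / 2) = j * (j + 1) := Int.mul_ediv_cancel' (Int.even_mul_succ_self j).two_dvd
  have h1 : (0 : ℤ) ≤ j ^ 2 - j := by nlinarith [sq_nonneg (2 * j - 1), Int.le_self_sq j]
  have h2 : (1 : ℤ) ≤ c := by exact_mod_cast hc
  have h3 : 0 ≤ c * j ^ 2 - j * (j + 1) / 2 := by nlinarith [sq_nonneg j]
  rw [burgeExp, Int.toNat_of_nonneg h3]
  linear_combination -h

/-- The exponent grows by exactly (bj)², the Gaussian factor that the Burge transform emits. -/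
theorem burgeExp_add_mul {a b : ℕ} (ha : 0 < a) (hb : 0 < b) (j : ℤ) :
    burgeExp ((a + b) * b) j = burgeExp (a * b) j + (b * j).natAbs ^ 2 := by
  have h1 := two_mul_burgeExp (mul_pos (add_pos ha hb) hb) j
  have h2 := two_mul_burgeExp (mul_pos ha hb) j
  have : (2 * (burgeExp ((a + b) * b) j : ℤ)) =
      2 * ((burgeExp (a * b) j : ℤ) + ((b * j).natAbs : ℤ) ^ 2) := by
    rw [mul_add, h1, h2, Int.natAbs_sq]; push_cast; ring
  exact_mod_cast mul_left_cancel₀ two_ne_zero this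

/-- Nonnegativity of `∑_j (-1)^j q^(e j) [2L, L - K j]` for all `L`. -/
def IsPositive (e : ℤ → ℕ) (K : ℕ) : Prop :=
  ∀ L N : ℕ, L ≤ N → HasNonnegCoeff (∑ j ∈ Finset.Icc (-N : ℤ) N,
    (j.negOnePow : ℤ) • (X ^ e j * qBinom (2 * L : ℕ) (L - K * j)))

/-- Apply the kernel identity with Kj for j and interchange the sums. The free cutoff N in
`IsPositive` gives the inner sums, with r ≤ L, the same range of j as the outer one. -/
theorem IsPositive.transform {e : ℤ → ℕ} {K p c : ℕ} {κ : ℕ → ℕ → ℤ[X]} (h : IsPositive e K)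
    (hκ : IsPositiveKernel p c κ) (hp : 0 < p) :
    IsPositive (fun j => p * e j + c * (K * j).natAbs ^ 2) (2 * K) := by
  intro L N hN
  have : ∑ j ∈ Finset.Icc (-N : ℤ) N, (j.negOnePow : ℤ) •
      (X ^ (p * e j + c * (K * j).natAbs ^ 2) * qBinom (2 * L : ℕ) (L - (2 * K : ℕ) * j)) =
      ∑ r ∈ Finset.range (L + 1), κ L r * expand ℤ p (∑ j ∈ Finset.Icc (-N : ℤ) N,
        (j.negOnePow : ℤ) • (X ^ e j * qBinom (2 * r : ℕ) (r - K * j))) := by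
    simp only [map_sum, Finset.mul_sum]
    rw [Finset.sum_comm]
    refine Finset.sum_congr rfl fun j _ => ?_
    simp only [map_zsmul, map_mul, map_pow, expand_X, mul_smul_comm, ← Finset.smul_sum]
    congr 1
    rw [pow_add, mul_assoc, show (L : ℤ) - (2 * K : ℕ) * j = L - 2 * (K * j) by push_cast; ring,
      ← hκ.sum_eq, Finset.mul_sum]
    refine Finset.sum_congr rfl fun r _ => ?_
    rw [pow_mul]; ring
  rw [this]
  refine HasNonnegCoeff.sum fun r hr => (hκ.nonneg L r).mul ((h r N ?_).expand hp)
  rw [Finset.mem_range] at hr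
  omega

/-- Nonnegativity of the sums of products of two `q`-binomial coefficients attached to `a, b`. -/
def IsBurgePositive (a b : ℕ) : Prop :=
  ∀ L M N : ℕ, L + M ≤ N → HasNonnegCoeff (∑ j ∈ Finset.Icc (-N : ℤ) N,
    (j.negOnePow : ℤ) • (X ^ burgeExp (a * b) j * burgeProd L M (a * j) (b * j)))

theorem IsBurgePositive.swap {a b : ℕ} (h : IsBurgePositive a b) : IsBurgePositive b a := by
  intro L M N hN
  have := h M L N (by omega)
  simpa only [mul_comm b a, burgeProd_swap] using this

theorem sum_burgeProd_mul (L M a b : ℕ) (j : ℤ) :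
    ∑ i ∈ Finset.range (L + 1), X ^ (i ^ 2) * qBinom (2 * L + M - i) (2 * L) *
        burgeProd (L - i) i (a * j) (b * j) =
      X ^ ((b * j).natAbs ^ 2) * burgeProd L M ((a + b) * j) (b * j) := by
  obtain ⟨n, rfl | rfl⟩ := j.eq_nat_or_neg
  · have := sum_burgeProd L M (a * n) (b * n)
    rw [show ((b : ℤ) * n).natAbs = b * n by rw [← Nat.cast_mul, Int.natAbs_natCast]]
    push_cast at this
    rw [this, add_mul]
  · have := sum_burgeProd L M (a * n) (b * n)
    rw [show ((b : ℤ) * -n).natAbs = b * n by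
      rw [mul_neg, Int.natAbs_neg, ← Nat.cast_mul, Int.natAbs_natCast]]
    push_cast at this
    simp only [mul_neg, burgeProd_neg]
    rw [this, add_mul]

theorem sum_burgeProd_limit_mul (L a b : ℕ) (j : ℤ) :
    ∑ i ∈ Finset.range (L + 1), X ^ (i ^ 2) * burgeProd (L - i) i (a * j) (b * j) =
      X ^ ((b * j).natAbs ^ 2) * qBinom (2 * L : ℕ) (L - (a + b) * j) := by
  obtain ⟨n, rfl | rfl⟩ := j.eq_nat_or_neg
  · have := sum_burgeProd_limit L (a * n) (b * n)
    rw [show ((b : ℤ) * n).natAbs = b * n by rw [← Nat.cast_mul, Int.natAbs_natCast]]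
    push_cast at this ⊢
    rw [this, add_mul]
  · have := sum_burgeProd_limit L (a * n) (b * n)
    rw [show ((b : ℤ) * -n).natAbs = b * n by
      rw [mul_neg, Int.natAbs_neg, ← Nat.cast_mul, Int.natAbs_natCast]]
    push_cast at this ⊢
    simp only [mul_neg, burgeProd_neg]
    rw [this, qBinom_symm (n := 2 * L) (k := L - (a * n + b * n)) (l := L + (a * n + b * n))
      (by ring)]
    congr 2
    ring

theorem IsBurgePositive.add {a b : ℕ} (ha : 0 < a) (hb : 0 < b) (h : IsBurgePositive a b) :
    IsBurgePositive (a + b) b := by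
  intro L M N hN
  have : ∑ j ∈ Finset.Icc (-N : ℤ) N, (j.negOnePow : ℤ) • (X ^ burgeExp ((a + b) * b) j *
      burgeProd L M ((a + b : ℕ) * j) (b * j)) =
      ∑ i ∈ Finset.range (L + 1), X ^ (i ^ 2) * qBinom (2 * L + M - i) (2 * L) *
        ∑ j ∈ Finset.Icc (-N : ℤ) N, (j.negOnePow : ℤ) • (X ^ burgeExp (a * b) j *
          burgeProd (L - i) i (a * j) (b * j)) := by
    simp only [Finset.mul_sum]
    rw [Finset.sum_comm]
    refine Finset.sum_congr rfl fun j _ => ?_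
    simp only [mul_smul_comm, ← Finset.smul_sum]
    congr 1
    rw [burgeExp_add_mul ha hb, pow_add, mul_assoc, Nat.cast_add, ← sum_burgeProd_mul,
      Finset.mul_sum]
    exact Finset.sum_congr rfl fun i _ => by ring
  rw [this]
  refine HasNonnegCoeff.sum fun i hi =>
    ((HasNonnegCoeff.X_pow _).mul (HasNonnegCoeff.qBinom _ _)).mul ?_
  rw [Finset.mem_range] at hi
  rw [← Nat.cast_sub (by omega)]
  exact h (L - i) i N (by omega)

theorem IsBurgePositive.isPositive {a b : ℕ} (ha : 0 < a) (hb : 0 < b) (h : IsBurgePositive a b) :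
    IsPositive (burgeExp ((a + b) * b)) (a + b) := by
  intro L N hN
  have : ∑ j ∈ Finset.Icc (-N : ℤ) N, (j.negOnePow : ℤ) • (X ^ burgeExp ((a + b) * b) j *
      qBinom (2 * L : ℕ) (L - (a + b : ℕ) * j)) =
      ∑ i ∈ Finset.range (L + 1), X ^ (i ^ 2) *
        ∑ j ∈ Finset.Icc (-N : ℤ) N, (j.negOnePow : ℤ) • (X ^ burgeExp (a * b) j *
          burgeProd (L - i) i (a * j) (b * j)) := by
    simp only [Finset.mul_sum]
    rw [Finset.sum_comm]
    refine Finset.sum_congr rfl fun j _ => ?_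
    simp only [mul_smul_comm, ← Finset.smul_sum]
    congr 1
    rw [burgeExp_add_mul ha hb, pow_add, mul_assoc, Nat.cast_add a b, ← sum_burgeProd_limit_mul,
      Finset.mul_sum]
    exact Finset.sum_congr rfl fun i _ => by ring
  rw [this]
  refine HasNonnegCoeff.sum fun i hi => (HasNonnegCoeff.X_pow _).mul ?_
  rw [Finset.mem_range] at hi
  rw [← Nat.cast_sub (by omega)]
  exact h (L - i) i N (by omega)

theorem triPow_fracX (j : ℤ) : triPow fracX j = fracX ^ burgeExp 1 j := by
  have hq := isGeneric_fracX
  have h0 := hq.ne_zero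
  have hb : ∀ j : ℤ, (burgeExp 1 (j + 1) : ℤ) = burgeExp 1 j + j := fun j => by
    have h1 := two_mul_burgeExp one_pos (j + 1)
    have h2 := two_mul_burgeExp one_pos j
    push_cast at h1 h2
    have : 2 * (burgeExp 1 (j + 1) : ℤ) = 2 * (burgeExp 1 j + j) := by
      linear_combination h1 - h2
    omega
  induction j using Int.induction_on with
  | zero => simp [triPow, zprod_zero, burgeExp]
  | succ i ih =>
    rw [triPow_succ hq (m := i) rfl, ih, ← zpow_natCast, ← zpow_natCast, hb, ← zpow_add₀ h0,
      add_comm]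
  | pred i ih =>
    have := triPow_succ hq (m := -(i : ℤ) - 1) (n := -i) (by ring)
    have hb' := hb (-(i : ℤ) - 1)
    rw [sub_add_cancel] at hb'
    rw [ih] at this
    refine mul_left_cancel₀ (zpow_ne_zero (-(i : ℤ) - 1) h0) ?_
    rw [← this, ← zpow_natCast, ← zpow_natCast, hb', zpow_add₀ h0, mul_comm]

theorem aeval_zsmul_negOnePow (j : ℤ) (P : ℤ[X]) :
    aeval fracX ((j.negOnePow : ℤ) • P) = (-1) ^ j * aeval fracX P := by
  rw [map_zsmul, zsmul_eq_mul, Int.cast_negOnePow]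

theorem isBurgePositive_one_one : IsBurgePositive 1 1 := by
  intro L M N hN
  have : ∑ j ∈ Finset.Icc (-N : ℤ) N, (j.negOnePow : ℤ) • (X ^ burgeExp (1 * 1) j *
      burgeProd L M ((1 : ℕ) * j) ((1 : ℕ) * j)) = X ^ (L * M) * qBinom (L + M : ℕ) L := by
    apply aeval_fracX_injective
    have key := sum_alternating_mul_fBinom isGeneric_fracX L M (N := N) (by omega)
    simp only [map_sum, aeval_zsmul_negOnePow, map_mul, map_pow, aeval_X, aeval_fracX_qBinom]
    rw [← key]
    refine Finset.sum_congr rfl fun j _ => ?_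
    rw [burgeProd, triPow_fracX, Nat.cast_one, one_mul, one_mul,
      show (L : ℤ) + M + j - j = (L + M : ℕ) by push_cast; ring,
      show (L : ℤ) + M - j + j = (L + M : ℕ) by push_cast; ring, map_mul, aeval_fracX_qBinom,
      aeval_fracX_qBinom, ← mul_assoc]
  rw [this]
  exact (HasNonnegCoeff.X_pow _).mul (HasNonnegCoeff.qBinom _ _)

/-- Subtractive Euclidean algorithm run backwards from (1, 1), by induction on a + b. -/
theorem isBurgePositive_of_coprime (n : ℕ) : ∀ a b : ℕ, a + b = n → 0 < a → 0 < b →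
    Nat.Coprime a b → IsBurgePositive a b := by
  induction n using Nat.strong_induction_on with
  | _ n ih =>
    intro a b hn ha hb hab
    rcases lt_trichotomy a b with h | rfl | h
    · obtain ⟨c, rfl⟩ := Nat.exists_eq_add_of_lt h
      have hc : Nat.Coprime (c + 1) a := by
        rw [add_assoc, add_comm a, Nat.coprime_add_self_right] at hab
        exact hab.symm
      have := (ih (c + 1 + a) (by omega) (c + 1) a rfl (by omega) ha hc).add (by omega) ha
      rw [show a + c + 1 = c + 1 + a by ring]
      exact this.swap
    · obtain rfl := (Nat.coprime_self a).mp hab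
      exact isBurgePositive_one_one
    · obtain ⟨c, rfl⟩ := Nat.exists_eq_add_of_lt h
      have hc : Nat.Coprime (c + 1) b := by
        rw [add_assoc, add_comm b, Nat.coprime_add_self_left] at hab
        exact hab
      have := (ih (c + 1 + b) (by omega) (c + 1) b rfl (by omega) hb hc).add (by omega) hb
      rwa [show b + c + 1 = c + 1 + b by ring]

/-- The sum is 1 for L = 0 and 0 for every L ≥ 1. -/
theorem isPositive_one : IsPositive (burgeExp 1) 1 := by
  intro L N hN
  rcases eq_or_ne L 0 with rfl | hL
  · rw [Finset.sum_eq_single 0]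
    · simpa [burgeExp] using HasNonnegCoeff.qBinom 0 0
    · intro j _ hj
      rw [qBinom_eq_zero (by push_cast; omega), mul_zero, smul_zero]
    · simp
  · have : ∑ j ∈ Finset.Icc (-N : ℤ) N, (j.negOnePow : ℤ) • (X ^ burgeExp 1 j *
        qBinom (2 * L : ℕ) (L - (1 : ℕ) * j)) = 0 := by
      apply aeval_fracX_injective
      simp only [map_sum, aeval_zsmul_negOnePow, map_mul, map_pow, aeval_X, aeval_fracX_qBinom,
        map_zero, Nat.cast_one, one_mul, ← triPow_fracX, ← mul_assoc]
      exact sum_alternating_fBinom isGeneric_fracX hL hN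
    rw [this]
    exact HasNonnegCoeff.zero

/-- Equality in b ≤ 2^k a has to be allowed: for a = 1 and b = 2^k the inductive step cannot
subtract 2^k a, as b would drop to 0. At k = 0 equality means a = b = 1. -/
theorem isPositive_burgeExp_mul (k : ℕ) : ∀ a b : ℕ, 0 < a → 0 < b → b ≤ 2 ^ k * a →
    Nat.Coprime a b → IsPositive (fun j => 2 ^ k * burgeExp (a * b) j) (2 ^ k * a) := by
  induction k with
  | zero =>
    intro a b ha hb hba hab
    simp only [pow_zero, one_mul] at hba ⊢
    rcases hba.eq_or_lt with rfl | h
    · obtain rfl := (Nat.coprime_self b).mp hab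
      exact isPositive_one
    · obtain ⟨c, rfl⟩ := Nat.exists_eq_add_of_lt h
      have hc : Nat.Coprime (c + 1) b := by
        rw [add_assoc, add_comm b, Nat.coprime_add_self_left] at hab
        exact hab
      -- Start from the coprime pair (a - b, b); the limiting Burge step turns it into modulus a.
      have := (isBurgePositive_of_coprime _ (c + 1) b rfl (by omega) hb hc).isPositive (by omega) hb
      rwa [show b + c + 1 = c + 1 + b by ring]
  | succ k ih =>
    intro a b ha hb hba hab
    have h2 : 2 * (2 ^ k * a) = 2 ^ (k + 1) * a := by ring
    rcases le_or_gt b (2 ^ k * a) with h | h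
    · have := (ih a b ha hb h hab).transform isPositiveKernel_quadratic two_pos
      rw [h2] at this
      convert this using 2 with j
      ring
    -- For b > 2^k a, the kernel with c = 2 carries b - 2^k a to b: it adds 2 (2^k a j)², which is
    -- 2^(k+1) a (2^k a) j².
    · obtain ⟨c, rfl⟩ := Nat.exists_eq_add_of_lt h
      have hc : Nat.Coprime a (c + 1) := by
        simpa [add_assoc] using hab
      have := (ih a (c + 1) ha (by omega) (by rw [← h2] at hba; omega) hc).transform
        isPositiveKernel_quadraticDual two_pos
      rw [h2] at this
      convert this using 2 with j
      have e1 := two_mul_burgeExp (mul_pos ha hb) j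
      have e2 := two_mul_burgeExp (mul_pos ha (Nat.succ_pos c)) j
      zify
      rw [sq_abs]
      push_cast at e1 e2 ⊢
      linear_combination (2 ^ k : ℤ) * (e1 - e2)

end Positivity

/-! ### From polynomial positivity to the parameters (α, β, K) -/

section Transfer

theorem qPow_natCast (n : ℕ) : qPow n = ofPoly (X ^ n) := by
  rw [ofPoly, map_pow, aeval_X, qPow, qPow, AddMonoidAlgebra.single_pow, one_pow, nsmul_one]

theorem ofPoly_zsmul (n : ℤ) (P : ℤ[X]) : ofPoly (n • P) = n • ofPoly P :=
  map_zsmul (aeval (qPow 1)) n P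

theorem G_eq_ofPoly {e : ℤ → ℕ} {α β : ℚ} {K : ℕ} (hK : 0 < K)
    (he : ∀ j : ℤ, (e j : ℚ) = K * j * ((α + β) * j + α - β) / 2) (L : ℕ) :
    G L α β K = ofPoly (∑ j ∈ Finset.Icc (-L : ℤ) L,
      (j.negOnePow : ℤ) • (X ^ e j * qBinom (2 * L : ℕ) (L - K * j))) := by
  have hterm : ∀ j : ℤ, GTerm L L α β K j = ofPoly ((j.negOnePow : ℤ) •
      (X ^ e j * qBinom (2 * L : ℕ) (L - K * j))) := fun j => by
    rw [GTerm, ofPoly_zsmul]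
    congr 1
    rw [Int.cast_natCast, ← he, qPow_natCast]
    simp only [ofPoly, map_mul]
    rw [Nat.cast_mul, Nat.cast_two, two_mul]
  have hsupp : Function.support (GTerm L L α β K) ⊆ (Finset.Icc (-L : ℤ) L : Finset ℤ) := by
    intro j hj
    have h : 0 ≤ (L : ℤ) - K * j ∧ (L : ℤ) - K * j ≤ L + L := by
      by_contra h
      exact hj (by rw [GTerm, qBinom, if_neg h, ofPoly, map_zero, mul_zero, smul_zero])
    have h1 : |(K : ℤ) * j| ≤ L := abs_le.mpr ⟨by linarith, by linarith⟩
    have h2 : |j| ≤ |(K : ℤ) * j| := by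
      rw [abs_mul]
      exact le_mul_of_one_le_left (abs_nonneg j) (Int.one_le_abs (by exact_mod_cast hK.ne'))
    rw [Finset.mem_coe, Finset.mem_Icc]
    exact abs_le.mp (h2.trans h1)
  rw [G, G₂, finsum_eq_sum_of_support_subset _ hsupp, Finset.sum_congr rfl fun j _ => hterm j]
  simp only [ofPoly, map_sum]

theorem IsPositive.isNonnegPoly {e : ℤ → ℕ} {α β : ℚ} {K : ℕ} (h : IsPositive e K) (hK : 0 < K)
    (he : ∀ j : ℤ, (e j : ℚ) = K * j * ((α + β) * j + α - β) / 2) (L : ℤ) :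
    IsNonnegPoly (G L α β K) := by
  rcases L with L | L
  · exact ⟨_, h L L le_rfl, G_eq_ofPoly hK he L⟩
  · refine ⟨0, fun n => by simp, ?_⟩
    rw [G, G₂, ofPoly, map_zero]
    refine finsum_eq_zero_of_forall_eq_zero fun j => ?_
    rw [GTerm, qBinom, if_neg (by omega), ofPoly, map_zero, mul_zero, smul_zero]

/-- `(α, β, K)` satisfies the hypotheses of the generalized Borwein conjecture, its exponents are
natural numbers, and all the sums `G(L; α, β, K)` have nonnegative coefficients. -/
structure IsPositiveCase (α β : ℚ) (K : ℕ) : Prop where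
  pos : 0 < K
  param : IsBressoudParam α β K
  positive : ∃ e : ℤ → ℕ, (∀ j : ℤ, (e j : ℚ) = K * j * ((α + β) * j + α - β) / 2) ∧
    IsPositive e K

theorem IsPositiveCase.bressoudCaseHolds {α β : ℚ} {K : ℕ} (h : IsPositiveCase α β K) :
    BressoudCaseHolds α β K := by
  obtain ⟨e, he, hp⟩ := h.positive
  exact ⟨h.param, hp.isNonnegPoly h.pos he⟩

/-- Multiplying the exponent by p and adding c (Kj)² keeps its shape at modulus 2K, with α and β
replaced by (pα + cK)/2 and (pβ + cK)/2. -/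
theorem exists_exponent_transform {α β : ℚ} {K p c : ℕ} {κ : ℕ → ℕ → ℤ[X]}
    (h : IsPositiveCase α β K) (hκ : IsPositiveKernel p c κ) (hp : 0 < p) :
    ∃ e : ℤ → ℕ, (∀ j : ℤ, (e j : ℚ) = (2 * K : ℕ) * j *
      ((((p * α + c * K) / 2) + ((p * β + c * K) / 2)) * j + (p * α + c * K) / 2 -
        (p * β + c * K) / 2) / 2) ∧ IsPositive e (2 * K) := by
  obtain ⟨e, he, hp'⟩ := h.positive
  refine ⟨_, fun j => ?_, hp'.transform hκ hp⟩
  have : (((K * j : ℤ).natAbs ^ 2 : ℕ) : ℚ) = (K * j) ^ 2 := by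
    rw [Nat.cast_pow, Nat.cast_natAbs, Int.cast_abs, sq_abs, Int.cast_mul, Int.cast_natCast]
  rw [Nat.cast_add, Nat.cast_mul, Nat.cast_mul, this, he]
  push_cast
  ring

theorem IsPositiveCase.quadratic {α β : ℚ} {K : ℕ} (h : IsPositiveCase α β K) :
    IsPositiveCase α β (2 * K) := by
  refine ⟨by have := h.pos; omega, ?_, ?_⟩
  · obtain ⟨⟨m, hm⟩, ⟨n, hn⟩, h1, h2, h3, h4, h5, h6⟩ := h.param
    rw [Int.cast_natCast] at *
    have : (0 : ℚ) ≤ K := K.cast_nonneg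
    refine ⟨⟨2 * m, ?_⟩, ⟨2 * n, ?_⟩, h1, ?_, h3, ?_, h5, ?_⟩ <;> push_cast <;>
      first | linarith
  · convert exists_exponent_transform h isPositiveKernel_quadratic two_pos using 8 <;> simp

theorem IsPositiveCase.quartic {α β : ℚ} {K : ℕ} (h : IsPositiveCase α β K) :
    IsPositiveCase (2 * α) (2 * β) (2 * K) := by
  refine ⟨by have := h.pos; omega, ?_, ?_⟩
  · obtain ⟨⟨m, hm⟩, ⟨n, hn⟩, h1, h2, h3, h4, h5, h6⟩ := h.param
    rw [Int.cast_natCast] at *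
    refine ⟨⟨4 * m, ?_⟩, ⟨4 * n, ?_⟩, ?_, ?_, ?_, ?_, ?_, ?_⟩ <;> push_cast <;>
      linarith
  · have := exists_exponent_transform h isPositiveKernel_quartic four_pos
    have e : ∀ x : ℚ, ((4 : ℕ) * x + (0 : ℕ) * K) / 2 = 2 * x := fun x => by push_cast; ring
    simpa only [e] using this

theorem IsPositiveCase.selfDual {α β : ℚ} {K : ℕ} (h : IsPositiveCase α β K) :
    IsPositiveCase (α + K / 2) (β + K / 2) (2 * K) := by
  have hK : (1 : ℚ) ≤ K := by exact_mod_cast h.pos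
  refine ⟨by have := h.pos; omega, ?_, ?_⟩
  · obtain ⟨⟨m, hm⟩, ⟨n, hn⟩, h1, h2, h3, h4, h5, h6⟩ := h.param
    rw [Int.cast_natCast] at *
    refine ⟨⟨2 * m + K ^ 2, ?_⟩, ⟨2 * n + K ^ 2, ?_⟩, ?_, ?_, ?_, ?_, ?_, ?_⟩ <;> push_cast <;>
      linarith
  · have := exists_exponent_transform h isPositiveKernel_selfDual two_pos
    have e : ∀ x : ℚ, ((2 : ℕ) * x + (1 : ℕ) * K) / 2 = x + K / 2 := fun x => by push_cast; ring
    simpa only [e] using this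

theorem IsPositiveCase.rogersSzego {α β : ℚ} {K : ℕ} (h : IsPositiveCase α β K) :
    IsPositiveCase ((α + K) / 2) ((β + K) / 2) (2 * K) := by
  have hK : (1 : ℚ) ≤ K := by exact_mod_cast h.pos
  refine ⟨by have := h.pos; omega, ?_, ?_⟩
  · obtain ⟨⟨m, hm⟩, ⟨n, hn⟩, h1, h2, h3, h4, h5, h6⟩ := h.param
    rw [Int.cast_natCast] at *
    refine ⟨⟨m + K ^ 2, ?_⟩, ⟨n + K ^ 2, ?_⟩, ?_, ?_, ?_, ?_, ?_, ?_⟩ <;> push_cast <;>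
      linarith
  · have := exists_exponent_transform h isPositiveKernel_rogersSzego one_pos
    simpa only [Nat.cast_one, one_mul] using this

/-- With α = b - 1/a, β = b and K = 2^k a the exponent is 2^k (ab j² - j(j+1)/2). The strict
inequality b < 2^k a is needed for the bound α + β ≤ 2K - 1. -/
theorem isPositiveCase_base {k a b : ℕ} (hb : 0 < b) (hba : b < 2 ^ k * a)
    (hab : Nat.Coprime a b) : IsPositiveCase ((b : ℚ) - 1 / a) b (2 ^ k * a) := by
  have ha : 0 < a := Nat.pos_of_ne_zero fun h => by simp [h] at hba
  have ha' : (a : ℚ) ≠ 0 := by exact_mod_cast ha.ne'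
  have ha1 : (1 : ℚ) / a ≤ 1 := by
    rw [div_le_one (by exact_mod_cast ha)]; exact_mod_cast ha
  have ha0 : (0 : ℚ) ≤ 1 / a := by positivity
  have hb1 : (1 : ℚ) ≤ b := by exact_mod_cast hb
  have hba1 : (b : ℚ) + 1 ≤ 2 ^ k * a := by exact_mod_cast hba
  refine ⟨by omega, ⟨⟨2 ^ k * (a * b - 1), ?_⟩, ⟨b * (2 ^ k * a), ?_⟩, ?_, ?_, ?_, ?_, ?_, ?_⟩,
    fun j => 2 ^ k * burgeExp (a * b) j, fun j => ?_,
    isPositive_burgeExp_mul k a b ha hb hba.le hab⟩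
  · push_cast; field_simp
  all_goals push_cast
  · rfl
  iterate 6 linarith
  · have := congrArg (Int.cast : ℤ → ℚ) (two_mul_burgeExp (mul_pos ha hb) j)
    push_cast at this
    field_simp
    linear_combination this

theorem IsPositiveCase.quadratic_iterate {α β : ℚ} {K : ℕ} (h : IsPositiveCase α β K) (n : ℕ) :
    IsPositiveCase α β (2 ^ n * K) := by
  induction n with
  | zero => simpa using h
  | succ n ih =>
    have := ih.quadratic
    rwa [← mul_assoc, ← pow_succ'] at this

theorem IsPositiveCase.quartic_iterate {α β : ℚ} {K : ℕ} (h : IsPositiveCase α β K) (n : ℕ) :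
    IsPositiveCase (2 ^ n * α) (2 ^ n * β) (2 ^ n * K) := by
  induction n with
  | zero => simpa using h
  | succ n ih =>
    have := ih.quartic
    rwa [← mul_assoc, ← mul_assoc, ← mul_assoc, ← pow_succ', ← pow_succ'] at this

/-- One round, self-dual then Rogers–Szegő, sends α to (α + K/2 + 2K)/2 = α/2 + 5K/4 and K to 4K.
After m rounds the increments form a geometric series of ratio 8 with sum (5/14) (8^m - 1) K / 2^m.
-/
theorem IsPositiveCase.alternating_iterate {α β : ℚ} {K : ℕ} (h : IsPositiveCase α β K) (m : ℕ) :
    IsPositiveCase ((α + 5 / 14 * (8 ^ m - 1) * K) / 2 ^ m)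
      ((β + 5 / 14 * (8 ^ m - 1) * K) / 2 ^ m) (2 ^ (2 * m) * K) := by
  induction m with
  | zero => simpa using h
  | succ m ih =>
    have h8 : (8 : ℚ) ^ m = (2 ^ m) ^ 3 := by rw [← pow_mul, mul_comm, pow_mul]; norm_num
    have e : ∀ x : ℚ, ((x + 5 / 14 * (8 ^ m - 1) * K) / 2 ^ m + (2 ^ (2 * m) * K : ℕ) / 2 +
        (2 * (2 ^ (2 * m) * K) : ℕ)) / 2 =
        (x + 5 / 14 * (8 ^ (m + 1) - 1) * K) / 2 ^ (m + 1) := fun x => by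
      push_cast
      rw [pow_succ 8, pow_succ, pow_mul', h8]
      field_simp
      ring
    have := ih.selfDual.rogersSzego
    rw [e, e] at this
    convert this using 1
    ring

/-- A further self-dual step after m full rounds. The exponents `m + 1` match the indexing of the
fourth family, which starts at 1. -/
theorem IsPositiveCase.alternating_iterate_selfDual {α β : ℚ} {K : ℕ} (h : IsPositiveCase α β K)
    (m : ℕ) : IsPositiveCase (2 * (α + 1 / 28 * (3 * 8 ^ (m + 1) - 10) * K) / 2 ^ (m + 1))
      (2 * (β + 1 / 28 * (3 * 8 ^ (m + 1) - 10) * K) / 2 ^ (m + 1)) (2 ^ (2 * m + 1) * K) := by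
  have h8 : (8 : ℚ) ^ m = (2 ^ m) ^ 3 := by rw [← pow_mul, mul_comm, pow_mul]; norm_num
  have e : ∀ x : ℚ, (x + 5 / 14 * (8 ^ m - 1) * K) / 2 ^ m + (2 ^ (2 * m) * K : ℕ) / 2 =
      2 * (x + 1 / 28 * (3 * 8 ^ (m + 1) - 10) * K) / 2 ^ (m + 1) := fun x => by
    push_cast
    rw [pow_succ 8, pow_succ, pow_mul', h8]
    field_simp
    ring
  have := (h.alternating_iterate m).selfDual
  rw [e, e] at this
  convert this using 1
  ring

end Transfer

end BorweinBressoud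

/-! ### Assembly of the four families -/

theorem theorem9p8 (a b : ℤ) (k : ℕ) (hab : IsCoprime a b) (hb : 0 < b) (hba : b < 2 ^ k * a) :
    -- `G(L; b - 1/a, b, 2^k a) ≥ 0`
    BorweinBressoud.BressoudCaseHolds ((b : ℚ) - 1 / a) b (2 ^ k * a) ∧
    -- `G(L; 2^i (b - 1/a), 2^i b, 2^(k + k') a) ≥ 0`
    (∀ k' i : ℕ, i ≤ k' →
      BorweinBressoud.BressoudCaseHolds (2 ^ i * ((b : ℚ) - 1 / a)) (2 ^ i * b)
        (2 ^ (k + k') * a)) ∧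
    -- the two families obtained by alternating two further transformations
    (∀ m : ℕ,
      BorweinBressoud.BressoudCaseHolds
        (((b : ℚ) - 1 / a + 5 / 14 * (8 ^ m - 1) * (2 ^ k * a)) / 2 ^ m)
        (((b : ℚ) + 5 / 14 * (8 ^ m - 1) * (2 ^ k * a)) / 2 ^ m)
        (2 ^ (2 * m + k) * a)) ∧
    (∀ m : ℕ, 1 ≤ m →
      BorweinBressoud.BressoudCaseHolds
        (2 * ((b : ℚ) - 1 / a + 1 / 28 * (3 * 8 ^ m - 10) * (2 ^ k * a)) / 2 ^ m)
        (2 * ((b : ℚ) + 1 / 28 * (3 * 8 ^ m - 10) * (2 ^ k * a)) / 2 ^ m)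
        (2 ^ (2 * m + k - 1) * a)) := by
  have ha : 0 < a := pos_of_mul_pos_right (hb.trans hba) (by positivity)
  lift a to ℕ using ha.le
  lift b to ℕ using hb.le
  have h := BorweinBressoud.isPositiveCase_base (k := k) (a := a) (b := b) (by exact_mod_cast hb)
    (by exact_mod_cast hba) (Nat.isCoprime_iff_coprime.mp hab)
  simp only [Int.cast_natCast]
  refine ⟨?_, fun k' i hi => ?_, fun m => ?_, fun m hm => ?_⟩
  · simpa using h.bressoudCaseHolds
  · obtain ⟨n, rfl⟩ := Nat.exists_eq_add_of_le hi
    -- Of the k' doublings of K, i also double α and β; the other k' - i leave them fixed.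
    have := ((h.quartic_iterate i).quadratic_iterate n).bressoudCaseHolds
    convert this using 1
    push_cast
    ring
  · have := (h.alternating_iterate m).bressoudCaseHolds
    push_cast at this
    convert this using 1
    ring
  · obtain ⟨m, rfl⟩ := Nat.exists_eq_add_of_le' hm
    have := (h.alternating_iterate_selfDual m).bressoudCaseHolds
    push_cast at this
    rw [show 2 * (m + 1) + k - 1 = 2 * m + 1 + k by omega]
    convert this using 1
    ring
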